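/- Let $(I,\mathbb A,m)$ be a measure space with $m(I)<\infty$, and write $|J|=m(J)$. Let $0<\lambda_1<\lambda_2<1$ and let $\mathcal P=(\mathcal P^k)_{k\ge 0}$ be a $(\lambda_1,\lambda_2)$-good grid: each $\mathcal P^k$ is a finite family of pairwise disjoint measurable sets of positive measure that cover $I$ up to a null set, no set belongs to two different levels, $\mathcal P^0=\{I\}$, every $Q\in\mathcal P^{k+1}$ is contained in some $P\in\mathcal P^{k}$, $\lambda_1\le |Q|/|P|\le\lambda_2$ whenever $Q\in\mathcal P^{k+1}$, $P\in\mathcal P^k$, $Q\subset P$, and $\bigcup_k\mathcal P^k$ generates $\mathbb A$. Let $s>0$, $p\in[1,\infty)$, $q\in[1,\infty]$; for $q=\infty$ the outer sums below are replaced by suprema. Functions $f:I\to\mathbb C$ are identified when they agree almost everywhere. **Souza's atoms.** A Souza atom on $Q\in\mathcal P$ is a function $a_Q:I\to\mathbb C$ that vanishes off $Q$, is constant on $Q$, and satisfies $|a_Q|_\infty\le|Q|^{s-1/p}$. The space $\mathcal B^s_{p,q}$ consists of all $f\in L^p$ that are sums of an absolutely convergent series in $L^p$, $f=\sum_k\sum_{Q\in\mathcal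 P^k}c_Qa_Q$ (that is, $\sum_k|\sum_{Q\in\mathcal P^k}c_Qa_Q|_p<\infty$), with Souza atoms $a_Q$, coefficients $c_Q\in\mathbb C$, and finite cost $\big(\sum_k(\sum_{Q\in\mathcal P^k}|c_Q|^p)^{q/p}\big)^{1/q}$. Let $|f|_{\mathcal B^s_{p,q}}$ be the infimum of the costs of all such series ($\infty$ if there is none). **Haar coefficients.** For $Q\in\mathcal P^k$ let the children of $Q$ be the elements of $\mathcal P^{k+1}$ contained in $Q$. For a finite family $T=\{R_1,\dots,R_n\}$, $n\ge2$, with an arbitrarily chosen ordering, cut it into $\{R_1,\dots,R_{[n/2]}\}$ and $\{R_{[n/2]+1},\dots,R_n\}$. Let $\mathcal H_Q$ be the set of all pairs $S=(S_1,S_2)$ obtained by cutting the family of children of $Q$, and then cutting repeatedly all resulting families that have at least two elements. With $|S_i|=\sum_{P\in S_i}|P|$ put $$\phi_S=\Big(\frac1{|S_1|}+\frac1{|S_2|}\Big)^{-1/2}\Big(\frac{\sum_{P\in S_1}1_P}{|S_1|}-\frac{\sum_{P\in S_2}1_P}{|S_2|}\Big),\qquad \phi_I=\frac{1_I}{|I|^{1/2}},$$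 $d_S^f=\int f\phi_S\,dm$, $d_I^f=\int f\phi_I\,dm$, and $$N_{haar}(f)=|I|^{1/p-s-1/2}|d_I^f|+\Big(\sum_k\Big(\sum_{Q\in\mathcal P^k}|Q|^{1-sp-p/2}\sum_{S\in\mathcal H_Q}|d_S^f|^p\Big)^{q/p}\Big)^{1/q}.$$ **Standard atomic representation.** Put $k_I^f=|I|^{1/p-s-1/2}d_I^f$ and, for a child $P$ of $Q$ and any $x_P\in P$, $k_P^f=|P|^{-(s-1/p)}\sum_{S\in\mathcal H_Q}d_S^f\phi_S(x_P)$; let $$N_{st}(f)=|k_I^f|+\Big(\sum_{k\ge1}\Big(\sum_{Q\in\mathcal P^k}|k_Q^f|^p\Big)^{q/p}\Big)^{1/q}.$$ **Mean oscillation.** With $osc_p(f,Q)=\inf_{c\in\mathbb C}(\int_Q|f-c|^p\,dm)^{1/p}$ let $$N_{osc}(f)=|I|^{-s}|f|_p+\Big(\sum_k\Big(\sum_{Q\in\mathcal P^k}|Q|^{-sp}osc_p(f,Q)^p\Big)^{q/p}\Big)^{1/q}.$$ **Theorem 13.1.** $\mathcal B^s_{p,q}$ is a complex linear subspace of $L^1$.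 For every $f\in L^1$, each of $|f|_{\mathcal B^s_{p,q}}$, $N_{st}(f)$, $N_{haar}(f)$, $N_{osc}(f)$ is finite if and only if $f\in\mathcal B^s_{p,q}$. The four quantities are norms on $\mathcal B^s_{p,q}$, and they are equivalent: for every $f\in L^1$ (with values in $[0,\infty]$) $$|f|_{\mathcal B^s_{p,q}}\le N_{st}(f),\quad N_{st}(f)\le C_{st}N_{haar}(f),\quad N_{haar}(f)\le C_{w}N_{osc}(f),\quad N_{osc}(f)\le C_{o}|f|_{\mathcal B^s_{p,q}},$$ where $$C_w=\frac{\lambda_2^{1/2}}{\sqrt2\,\lambda_1^{3/2}}+1,\qquad C_{st}=1+C_w\max\{\lambda_2^{1/p-s},\lambda_1^{1/p-s}\}\,\lambda_1^{-2-1/p},$$ $$C_o=M^{1+1/p}\,C\,|I|^{-s}+\frac1{1-\lambda_2^s}<\infty .$$ Here $M=\sup_k\sup_{Q\in\mathcal P^k}\#\{P\in\mathcal P^k: P\cap Q\ne\emptyset\}$ and, with $|\mathcal P^k|=\max_{Q\in\mathcal P^k}|Q|$, $C=\big(\sum_k|\mathcal P^k|^{sq'}\big)^{1/q'}$, $1/q+1/q'=1$,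 if $q>1$, and $C=\sup_k|\mathcal P^k|^{s}$ if $q=1$. -/

import Mathlib

open MeasureTheory Filter Topology
open scoped ENNReal

noncomputable section

namespace GridBesov

/-- A grid on a measure space `(I, m)`: a sequence of finite families of measurable sets of positive
measure, not all of them empty, for which the number of elements of one level that meet a given
element of the same level is bounded, and such that no set belongs to two different levels. -/
structure Grid {I : Type*} [MeasurableSpace I] (m : Measure I) where
  /-- the family of cells of level `k` -/
  cells : ℕ → Finset (Set I)
  measurableSet_of_mem : ∀ k, ∀ Q ∈ cells k, MeasurableSet Q
  measure_pos : ∀ k, ∀ Q ∈ cells k, 0 < m Q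
  exists_nonempty : ∃ k, (cells k).Nonempty
  overlap_lt_top :
    (⨆ k, ⨆ Q ∈ cells k, (({P ∈ (cells k : Set (Set I)) | (P ∩ Q).Nonempty}.encard : ℕ∞) : ℝ≥0∞)) < ∞
  ne_of_ne : ∀ i j, i ≠ j → ∀ P ∈ cells i, ∀ Q ∈ cells j, P ≠ Q

variable {I : Type*} [MeasurableSpace I] {m : Measure I}

/-- The largest number of cells of one level that meet a given cell of that level. -/
def Grid.overlap (G : Grid m) : ℝ≥0∞ :=
  ⨆ k, ⨆ Q ∈ G.cells k,
    (({P ∈ (G.cells k : Set (Set I)) | (P ∩ Q).Nonempty}.encard : ℕ∞) : ℝ≥0∞)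

/-- The largest measure `|P^k|` of a cell of level `k`. -/
def Grid.mesh (G : Grid m) (k : ℕ) : ℝ≥0∞ := ⨆ Q ∈ G.cells k, m Q

/-- A `(l₁, l₂)`-good grid. -/
structure Grid.IsGood (G : Grid m) (l₁ l₂ : ℝ) : Prop where
  pos : 0 < l₁
  lt : l₁ < l₂
  lt_one : l₂ < 1
  cells_zero : G.cells 0 = {Set.univ}
  cover : ∀ k, m (⋃ Q ∈ G.cells k, Q)ᶜ = 0
  disjoint : ∀ k, ∀ P ∈ G.cells k, ∀ Q ∈ G.cells k, P ≠ Q → Disjoint P Q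
  exists_parent : ∀ k, ∀ Q ∈ G.cells (k + 1), ∃ P ∈ G.cells k, Q ⊆ P
  ratio : ∀ k, ∀ Q ∈ G.cells (k + 1), ∀ P ∈ G.cells k, Q ⊆ P →
    l₁ ≤ m.real Q / m.real P ∧ m.real Q / m.real P ≤ l₂
  generate : ‹MeasurableSpace I› =
    MeasurableSpace.generateFrom (⋃ k, (G.cells k : Set (Set I)))

/-! ### Mixed sequence norms -/

/-- The `ℓ^q` norm, `1 ≤ q ≤ ∞`, of a sequence in `[0, ∞]`. -/
def lqNorm (q : ℝ≥0∞) (a : ℕ → ℝ≥0∞) : ℝ≥0∞ :=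
  if q = ∞ then ⨆ k, a k else (∑' k, a k ^ q.toReal) ^ (1 / q.toReal)

/-- The `ℓ^p` norm of a finite family in `[0, ∞]`. -/
def lpSum {ι : Type*} (p : ℝ) (F : Finset ι) (a : ι → ℝ≥0∞) : ℝ≥0∞ :=
  (∑ i ∈ F, a i ^ p) ^ (1 / p)

/-! ### The Besov space defined by Souza's atoms -/

/-- `(s, p)`-Souza's atoms supported on `Q`. -/
structure IsSouzaAtom (m : Measure I) (s p : ℝ) (Q : Set I) (a : I → ℂ) : Prop where
  eq_zero : ∀ x, x ∉ Q → a x = 0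
  const : ∃ c, ∀ x ∈ Q, a x = c
  norm_le : eLpNorm a ∞ m ≤ m Q ^ (s - 1 / p)

/-- The `k`-th block `∑_{Q ∈ P^k} c_Q a_Q` of an atomic series. -/
def Grid.block (G : Grid m) (c : Set I → ℂ) (a : Set I → I → ℂ) (k : ℕ) (x : I) : ℂ :=
  ∑ Q ∈ G.cells k, c Q * a Q x

/-- The cost `(∑_k (∑_{Q ∈ P^k} |c_Q|^p)^{q/p})^{1/q}` of a family of coefficients. -/
def Grid.cost (G : Grid m) (p : ℝ) (q : ℝ≥0∞) (c : Set I → ℂ) : ℝ≥0∞ :=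
  lqNorm q fun k => lpSum p (G.cells k) fun Q => ‖c Q‖ₑ

/-- `f` is the sum in `L^p` of the series `∑_k ∑_{Q ∈ P^k} c_Q a_Q`, which converges absolutely in
`L^p`, with Souza's atoms `a_Q` (here `1 ≤ p < ∞`). -/
structure Grid.IsRepresentation (G : Grid m) (s p : ℝ) (c : Set I → ℂ) (a : Set I → I → ℂ)
    (f : I → ℂ) : Prop where
  atom : ∀ k, ∀ Q ∈ G.cells k, IsSouzaAtom m s p Q (a Q)
  abs_conv : (∑' k, eLpNorm (G.block c a k) (ENNReal.ofReal p) m) < ∞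
  tendsto : Tendsto
    (fun n : ℕ => eLpNorm (fun x => f x - ∑ k ∈ Finset.range n, G.block c a k x)
      (ENNReal.ofReal p) m) atTop (𝓝 0)

/-- The space `B^s_{p,q}`: the functions in `L^p` that have a representation of finite cost. -/
def Grid.besovSpace (G : Grid m) (s p : ℝ) (q : ℝ≥0∞) : Set (I → ℂ) :=
  {f | MemLp f (ENNReal.ofReal p) m ∧
    ∃ c a, G.IsRepresentation s p c a f ∧ G.cost p q c < ∞}

/-- The norm `|f|_{B^s_{p,q}}`: the infimum of the costs of the representations of `f`
(`∞` if there is none). -/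
def Grid.besovNorm (G : Grid m) (s p : ℝ) (q : ℝ≥0∞) (f : I → ℂ) : ℝ≥0∞ :=
  ⨅ (c : Set I → ℂ) (a : Set I → I → ℂ) (_ : G.IsRepresentation s p c a f), G.cost p q c

/-! ### Unbalanced Haar wavelets -/

open Classical in
/-- The children of a cell `Q` of level `k`. -/
def Grid.children (G : Grid m) (k : ℕ) (Q : Set I) : Finset (Set I) :=
  {P ∈ G.cells (k + 1) | P ⊆ Q}

/-- The arbitrary choices in the construction: an ordering of every finite family of cells, and a
point in every cell. -/
structure Grid.Choices (G : Grid m) where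
  order : Finset (Set I) → List (Set I)
  nodup_order : ∀ T, (order T).Nodup
  mem_order : ∀ T P, P ∈ order T ↔ P ∈ T
  pt : Set I → I
  pt_mem : ∀ k, ∀ P ∈ G.cells k, pt P ∈ P

open Classical in
/-- The family `T`, listed as `R₁, …, Rₙ` in its chosen order, is cut into `{R₁, …, R_[n/2]}` and
`{R_([n/2]+1), …, Rₙ}`. -/
def halves {α : Type*} (order : Finset α → List α) (T : Finset α) : Finset α × Finset α :=
  (((order T).take (T.card / 2)).toFinset, ((order T).drop (T.card / 2)).toFinset)

open Classical in
/-- The `j`-th generation of pairs obtained from `T`: the halves of `T`, then the halves of every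
component with at least two elements of a pair of the preceding generation. -/
def haarGen {α : Type*} (order : Finset α → List α) (T : Finset α) :
    ℕ → Finset (Finset α × Finset α)
  | 0 => {halves order T}
  | j + 1 => (haarGen order T j).biUnion fun S =>
      (({S.1, S.2} : Finset (Finset α)).filter fun R => 2 ≤ R.card).image (halves order)

open Classical in
/-- All pairs obtained from `T`. Generations from `T.card` on are empty, see `mem_haarPairs`. -/
def haarPairs {α : Type*} (order : Finset α → List α) (T : Finset α) :
    Finset (Finset α × Finset α) :=
  (Finset.range T.card).biUnion (haarGen order T)

theorem card_halves {α : Type*} (order : Finset α → List α) (hn : ∀ T, (order T).Nodup)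
    (hm : ∀ T P, P ∈ order T ↔ P ∈ T) (T : Finset α) :
    (halves order T).1.card = T.card / 2 ∧ (halves order T).2.card = T.card - T.card / 2 := by
  classical
  have hl : (order T).length = T.card := by
    rw [← List.toFinset_card_of_nodup (hn T)]
    congr 1
    ext P
    simp [hm]
  have h1 : ((order T).take (T.card / 2)).Nodup := (hn T).sublist (List.take_sublist _ _)
  have h2 : ((order T).drop (T.card / 2)).Nodup := (hn T).sublist (List.drop_sublist _ _)
  constructor
  · have := List.toFinset_card_of_nodup h1
    simp only [List.length_take, hl] at this
    simp only [halves]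
    convert this using 1
    omega
  · have := List.toFinset_card_of_nodup h2
    simp only [List.length_drop, hl] at this
    simp only [halves]
    convert this using 1

theorem card_of_mem_haarGen {α : Type*} (order : Finset α → List α)
    (hn : ∀ T, (order T).Nodup) (hm : ∀ T P, P ∈ order T ↔ P ∈ T) (T : Finset α)
    (hT : 2 ≤ T.card) (j : ℕ) :
    ∀ S ∈ haarGen order T j, 1 ≤ S.1.card ∧ 1 ≤ S.2.card ∧ S.1.card + S.2.card + j ≤ T.card := by
  classical
  induction j with
  | zero =>
    intro S hS
    have h := card_halves order hn hm T
    simp only [haarGen, Finset.mem_singleton] at hS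
    subst hS
    omega
  | succ j ih =>
    intro S hS
    simp only [haarGen, Finset.mem_biUnion, Finset.mem_image, Finset.mem_filter,
      Finset.mem_insert, Finset.mem_singleton] at hS
    obtain ⟨S', hS', R, ⟨hR, hc⟩, rfl⟩ := hS
    have h := card_halves order hn hm R
    have h' := ih S' hS'
    rcases hR with rfl | rfl <;> omega

/-- `haarPairs` is the union of all generations. -/
theorem mem_haarPairs {α : Type*} (order : Finset α → List α)
    (hn : ∀ T, (order T).Nodup) (hm : ∀ T P, P ∈ order T ↔ P ∈ T) (T : Finset α)
    (hT : 2 ≤ T.card) (S : Finset α × Finset α) :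
    S ∈ haarPairs order T ↔ ∃ j, S ∈ haarGen order T j := by
  classical
  simp only [haarPairs, Finset.mem_biUnion, Finset.mem_range]
  constructor
  · rintro ⟨j, -, h⟩
    exact ⟨j, h⟩
  · rintro ⟨j, h⟩
    have := card_of_mem_haarGen order hn hm T hT j S h
    exact ⟨j, by omega, h⟩

/-- The family `H_Q` of a cell `Q` of level `k`. -/
def Grid.haarFamily (G : Grid m) (D : G.Choices) (k : ℕ) (Q : Set I) :
    Finset (Finset (Set I) × Finset (Set I)) :=
  haarPairs D.order (G.children k Q)

/-- The total measure `∑_{P ∈ F} |P|` of a family of cells. -/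
def totalMeasure (m : Measure I) (F : Finset (Set I)) : ℝ := ∑ P ∈ F, m.real P

/-- The Haar wavelet `φ_S` of the pair `S = (S₁, S₂)`. -/
def haarWavelet (m : Measure I) (S : Finset (Set I) × Finset (Set I)) (x : I) : ℝ :=
  1 / (1 / totalMeasure m S.1 + 1 / totalMeasure m S.2) ^ (1 / 2 : ℝ) *
    ((∑ P ∈ S.1, P.indicator (fun _ => (1 : ℝ)) x) / totalMeasure m S.1 -
      (∑ P ∈ S.2, P.indicator (fun _ => (1 : ℝ)) x) / totalMeasure m S.2)

/-- The Haar coefficient `d_S = ∫ f φ_S dm`. -/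
def haarCoeff (m : Measure I) (f : I → ℂ) (S : Finset (Set I) × Finset (Set I)) : ℂ :=
  ∫ x, f x * (haarWavelet m S x : ℂ) ∂m

/-- The Haar coefficient `d_I = ∫ f φ_I dm`, with `φ_I = 1_I / |I|^{1/2}`. -/
def haarCoeffTop (m : Measure I) (f : I → ℂ) : ℂ :=
  ∫ x, f x * ((1 / m.real Set.univ ^ (1 / 2 : ℝ) : ℝ) : ℂ) ∂m

/-- `N_haar(f) = |I|^{1/p-s-1/2} |d_I|
+ (∑_k (∑_{Q ∈ P^k} |Q|^{1-sp-p/2} ∑_{S ∈ H_Q} |d_S|^p)^{q/p})^{1/q}`. -/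
def Grid.haarNorm (G : Grid m) (D : G.Choices) (s p : ℝ) (q : ℝ≥0∞) (f : I → ℂ) : ℝ≥0∞ :=
  m Set.univ ^ (1 / p - s - 1 / 2) * ‖haarCoeffTop m f‖ₑ +
    lqNorm q fun k =>
      (∑ Q ∈ G.cells k, m Q ^ (1 - s * p - p / 2) *
        ∑ S ∈ G.haarFamily D k Q, ‖haarCoeff m f S‖ₑ ^ p) ^ (1 / p)

/-! ### The standard atomic representation -/

open Classical in
/-- The coefficient `k_P` of the canonical Souza's atom on `P` in the standard atomic representation:
`k_I = |I|^{1/p-s-1/2} d_I` at level `0`, and, at level `k + 1`,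
`k_P = |P|^{-(s-1/p)} ∑_{S ∈ H_Q} d_S φ_S(x_P)`, where `Q` is the cell of level `k` that contains
`P` (in a good grid the outer sum has this single term). -/
def Grid.stdCoeff (G : Grid m) (D : G.Choices) (s p : ℝ) (f : I → ℂ) : ℕ → Set I → ℂ
  | 0, _ => ((m.real Set.univ ^ (1 / p - s - 1 / 2) : ℝ) : ℂ) * haarCoeffTop m f
  | k + 1, P => ((1 / m.real P ^ (s - 1 / p) : ℝ) : ℂ) *
      ∑ Q ∈ G.cells k with P ⊆ Q, ∑ S ∈ G.haarFamily D k Q,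
        haarCoeff m f S * (haarWavelet m S (D.pt P) : ℂ)

/-- `N_st(f) = |k_I| + (∑_{k ≥ 1} (∑_{Q ∈ P^k} |k_Q|^p)^{q/p})^{1/q}`. -/
def Grid.stdNorm (G : Grid m) (D : G.Choices) (s p : ℝ) (q : ℝ≥0∞) (f : I → ℂ) : ℝ≥0∞ :=
  ‖G.stdCoeff D s p f 0 Set.univ‖ₑ +
    lqNorm q fun k => lpSum p (G.cells (k + 1)) fun Q => ‖G.stdCoeff D s p f (k + 1) Q‖ₑ

/-! ### Mean oscillation -/

/-- `osc_p(f, Q) = inf_c (∫_Q |f - c|^p dm)^{1/p}`. -/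
def osc (m : Measure I) (p : ℝ) (f : I → ℂ) (Q : Set I) : ℝ≥0∞ :=
  ⨅ c : ℂ, (∫⁻ x in Q, ‖f x - c‖ₑ ^ p ∂m) ^ (1 / p)

/-- `N_osc(f) = |I|^{-s} |f|_p + (∑_k (∑_{Q ∈ P^k} |Q|^{-sp} osc_p(f, Q)^p)^{q/p})^{1/q}`. -/
def Grid.oscNorm (G : Grid m) (s p : ℝ) (q : ℝ≥0∞) (f : I → ℂ) : ℝ≥0∞ :=
  m Set.univ ^ (-s) * eLpNorm f (ENNReal.ofReal p) m +
    lqNorm q fun k =>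
      (∑ Q ∈ G.cells k, m Q ^ (-(s * p)) * osc m p f Q ^ p) ^ (1 / p)

/-! ### Constants, and norms modulo null functions -/

/-- The constant of Hölder's inequality, for `1 ≤ t < ∞` and `1 ≤ q ≤ ∞`: it is
`(∑_k b_k^{q'/t})^{1/q'}` if `q > 1`, and `sup_k b_k^{1/t}` if `q = 1`. -/
def holderConst (t : ℝ) (q : ℝ≥0∞) (b : ℕ → ℝ≥0∞) : ℝ≥0∞ :=
  if q = 1 then ⨆ k, b k ^ (1 / t)
  else (∑' k, b k ^ (q.conjExponent.toReal / t)) ^ (1 / q.conjExponent.toReal)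

/-- `λ₂^{1/2} / (√2 λ₁^{3/2}) + 1`. -/
def waveletConst (l₁ l₂ : ℝ) : ℝ :=
  l₂ ^ (1 / 2 : ℝ) / (√2 * l₁ ^ (3 / 2 : ℝ)) + 1

/-- `1 + C max{λ₂^{1/p-s}, λ₁^{1/p-s}} λ₁^{-2-1/p}`, with `C` the constant `waveletConst`. -/
def stdConst (l₁ l₂ s p : ℝ) : ℝ :=
  1 + waveletConst l₁ l₂ * max (l₂ ^ (1 / p - s)) (l₁ ^ (1 / p - s)) * l₁ ^ (-2 - 1 / p)

/-- `M^{1+1/p} C(p, q, (|P^k|^{sp})_k) |I|^{-s} + 1 / (1 - λ₂^s)`, with `M` the overlap of the grid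
and `C` the constant `holderConst`. -/
def Grid.oscConst (G : Grid m) (l₂ s p : ℝ) (q : ℝ≥0∞) : ℝ≥0∞ :=
  G.overlap ^ (1 + 1 / p) * holderConst p q (fun k => G.mesh k ^ (s * p)) *
    m Set.univ ^ (-s) + ENNReal.ofReal (1 / (1 - l₂ ^ s))

/-- `V` is a complex linear space of functions and `N` is a norm on it, functions that agree almost
everywhere being identified. -/
structure IsNormOn (m : Measure I) (V : Set (I → ℂ)) (N : (I → ℂ) → ℝ≥0∞) : Prop where
  zero_mem : (fun _ => 0) ∈ V
  add_mem : ∀ f ∈ V, ∀ g ∈ V, (fun x => f x + g x) ∈ V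
  smul_mem : ∀ z : ℂ, ∀ f ∈ V, (fun x => z * f x) ∈ V
  lt_top : ∀ f ∈ V, N f < ∞
  add_le : ∀ f ∈ V, ∀ g ∈ V, N (fun x => f x + g x) ≤ N f + N g
  smul_eq : ∀ z : ℂ, ∀ f ∈ V, N (fun x => z * f x) = ‖z‖ₑ * N f
  eq_zero_iff : ∀ f ∈ V, N f = 0 ↔ f =ᵐ[m] fun _ => 0

end GridBesov

end

/-!
The four quantities are compared in a cycle.

* `besovNorm ≤ stdNorm`: the truncated Haar expansion of `f` telescopes, its `n`-th partial sum
  being the average of `f` over the cells of level `n`. So the standard atomic representation,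
  which converges absolutely in `L^p` as soon as its cost is finite, converges to `f` by Lévy's
  upward theorem.
* `stdNorm ≤ C_st haarNorm`: on a child of `Q` the functions `φ_S`, `S ∈ H_Q`, have a total size of
  order `|Q|^{-1/2}`, because a cell lies in few of the pairs of `H_Q`.
* `haarNorm ≤ C_w oscNorm`: `φ_S` has mean zero, so that `f - c` may replace `f` in `d_S`.
* `oscNorm ≤ C_o besovNorm`: on a cell of level `k` the atoms of levels `≤ k` are constant and do
  not contribute to the oscillation, and those of level `k + i` gain a factor `λ₂^{s i}`, whence
  the geometric series `1 / (1 - λ₂^s)`.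

Each of the four is an extended seminorm, so finiteness on exactly the Besov space and
definiteness pass from one to the others.
-/

noncomputable section

namespace GridBesov

/-! ### Mixed sequence norms -/

section lqNorm

variable {q : ℝ≥0∞}

lemma lqNorm_top (a : ℕ → ℝ≥0∞) : lqNorm ∞ a = ⨆ k, a k := if_pos rfl

lemma lqNorm_of_ne_top (hq : q ≠ ∞) (a : ℕ → ℝ≥0∞) :
    lqNorm q a = (∑' k, a k ^ q.toReal) ^ (1 / q.toReal) := if_neg hq

lemma lqNorm_eq_eLpNorm (hq : q ≠ 0) (a : ℕ → ℝ≥0∞) :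
    lqNorm q a = eLpNorm a q Measure.count := by
  obtain rfl | hq' := eq_or_ne q ∞
  · simp [lqNorm_top, eLpNormEssSup]
  · rw [lqNorm_of_ne_top hq', eLpNorm_eq_lintegral_rpow_enorm_toReal hq hq', lintegral_count]
    simp only [enorm_eq_self]

lemma lqNorm_mono {a b : ℕ → ℝ≥0∞} (h : ∀ k, a k ≤ b k) : lqNorm q a ≤ lqNorm q b := by
  unfold lqNorm
  split_ifs
  · exact iSup_mono h
  · gcongr with k
    exact h k

lemma lqNorm_add_le (hq : 1 ≤ q) (a b : ℕ → ℝ≥0∞) :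
    lqNorm q (fun k => a k + b k) ≤ lqNorm q a + lqNorm q b := by
  simp only [lqNorm_eq_eLpNorm (one_pos.trans_le hq).ne']
  exact eLpNorm_add_le Measurable.of_discrete.aestronglyMeasurable
    Measurable.of_discrete.aestronglyMeasurable hq

lemma lqNorm_const_mul (hq : q ≠ 0) (c : ℝ≥0∞) (a : ℕ → ℝ≥0∞) :
    lqNorm q (fun k => c * a k) = c * lqNorm q a := by
  obtain rfl | hq' := eq_or_ne q ∞
  · simp only [lqNorm_top, ENNReal.mul_iSup]
  · have hq0 := ENNReal.toReal_pos hq hq'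
    simp_rw [lqNorm_of_ne_top hq', ENNReal.mul_rpow_of_nonneg _ _ hq0.le, ENNReal.tsum_mul_left]
    rw [ENNReal.mul_rpow_of_nonneg _ _ (by positivity), one_div, ENNReal.rpow_rpow_inv hq0.ne']

lemma lqNorm_zero (hq : q ≠ 0) : lqNorm q (fun _ => 0) = 0 := by
  simpa using lqNorm_const_mul hq 0 fun _ => 0

lemma le_lqNorm (hq : q ≠ 0) (a : ℕ → ℝ≥0∞) (k : ℕ) : a k ≤ lqNorm q a := by
  obtain rfl | hq' := eq_or_ne q ∞
  · exact lqNorm_top a ▸ le_iSup a k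
  · rw [lqNorm_of_ne_top hq', one_div, ENNReal.le_rpow_inv_iff (ENNReal.toReal_pos hq hq')]
    exact ENNReal.le_tsum k

lemma lqNorm_shift_le (a : ℕ → ℝ≥0∞) (i : ℕ) : lqNorm q (fun k => a (k + i)) ≤ lqNorm q a := by
  unfold lqNorm
  split_ifs
  · exact iSup_le fun k => le_iSup a (k + i)
  · exact ENNReal.rpow_le_rpow (ENNReal.tsum_comp_le_tsum_of_injective (add_left_injective i)
      fun k => a k ^ q.toReal) (by positivity)

lemma lqNorm_le_head_add (hq : 1 ≤ q) (a : ℕ → ℝ≥0∞) :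
    lqNorm q a ≤ a 0 + lqNorm q (fun k => a (k + 1)) := by
  obtain rfl | hq' := eq_or_ne q ∞
  · simp only [lqNorm_top]
    refine iSup_le fun k => ?_
    cases k with
    | zero => exact le_self_add
    | succ k => exact (le_iSup (fun k => a (k + 1)) k).trans le_add_self
  · have hq1 : 1 ≤ q.toReal := by simpa using ENNReal.toReal_mono hq' hq
    rw [lqNorm_of_ne_top hq', lqNorm_of_ne_top hq', tsum_eq_zero_add' ENNReal.summable]
    refine (ENNReal.rpow_add_le_add_rpow _ _ (by positivity)
      ((div_le_one (by positivity)).2 hq1)).trans_eq ?_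
    rw [one_div, ENNReal.rpow_rpow_inv (by positivity)]

lemma lqNorm_le_of_tendsto (hq : q ≠ 0) {u : ℕ → ℕ → ℝ≥0∞} {a : ℕ → ℝ≥0∞} {B : ℝ≥0∞}
    (hu : ∀ n, lqNorm q (u n) ≤ B) (h : ∀ k, Tendsto (fun n => u n k) atTop (𝓝 (a k))) :
    lqNorm q a ≤ B := by
  obtain rfl | hq' := eq_or_ne q ∞
  · rw [lqNorm_top]
    exact iSup_le fun k => le_of_tendsto' (h k) fun n => (le_lqNorm hq (u n) k).trans (hu n)
  · have hq0 := ENNReal.toReal_pos hq hq'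
    simp only [lqNorm_of_ne_top hq', one_div, ENNReal.rpow_inv_le_iff hq0] at hu ⊢
    refine ENNReal.tsum_le_of_sum_range_le fun N => ?_
    have hN : Tendsto (fun n => ∑ k ∈ Finset.range N, u n k ^ q.toReal) atTop
        (𝓝 (∑ k ∈ Finset.range N, a k ^ q.toReal)) :=
      tendsto_finsetSum _ fun k _ => (ENNReal.continuous_rpow_const.tendsto _).comp (h k)
    exact le_of_tendsto' hN fun n => (ENNReal.sum_le_tsum _).trans (hu n)

lemma lqNorm_sum_le (hq : 1 ≤ q) {ι : Type*} (F : Finset ι) (u : ι → ℕ → ℝ≥0∞) :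
    lqNorm q (fun k => ∑ i ∈ F, u i k) ≤ ∑ i ∈ F, lqNorm q (u i) := by
  classical
  induction F using Finset.induction_on with
  | empty => simp [lqNorm_zero (one_pos.trans_le hq).ne']
  | insert i F hi ih =>
    simp only [Finset.sum_insert hi]
    exact (lqNorm_add_le hq _ _).trans (by gcongr)

lemma lqNorm_tsum_le (hq : 1 ≤ q) (u : ℕ → ℕ → ℝ≥0∞) :
    lqNorm q (fun k => ∑' i, u i k) ≤ ∑' i, lqNorm q (u i) :=
  lqNorm_le_of_tendsto (one_pos.trans_le hq).ne'
    (fun n => (lqNorm_sum_le hq (Finset.range n) u).trans (ENNReal.sum_le_tsum _))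
    fun k => ENNReal.tendsto_nat_tsum fun i => u i k

lemma lqNorm_convolution_le (hq : 1 ≤ q) (r a : ℕ → ℝ≥0∞) :
    lqNorm q (fun k => ∑' i, r i * a (k + i)) ≤ (∑' i, r i) * lqNorm q a := by
  rw [← ENNReal.tsum_mul_right]
  refine (lqNorm_tsum_le hq _).trans (ENNReal.tsum_le_tsum fun i => ?_)
  rw [lqNorm_const_mul (one_pos.trans_le hq).ne']
  gcongr
  exact lqNorm_shift_le a i

lemma lqNorm_geometric_lt_top (hq : q ≠ 0) {r : ℝ≥0∞} (hr : r < 1) :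
    lqNorm q (fun k => r ^ k) < ∞ := by
  obtain rfl | hq' := eq_or_ne q ∞
  · rw [lqNorm_top]
    exact (iSup_le fun k => pow_le_one' hr.le k).trans_lt ENNReal.one_lt_top
  · have hq0 := ENNReal.toReal_pos hq hq'
    have hpow : ∀ k, (r ^ k) ^ q.toReal = (r ^ q.toReal) ^ k := fun k => by
      rw [← ENNReal.rpow_natCast_mul, ← ENNReal.rpow_mul_natCast, mul_comm]
    simp_rw [lqNorm_of_ne_top hq', hpow, ENNReal.tsum_geometric]
    refine ENNReal.rpow_lt_top_of_nonneg (by positivity) (ENNReal.inv_lt_top.2 ?_).ne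
    exact tsub_pos_iff_lt.2 (ENNReal.rpow_lt_one hr hq0)

lemma tsum_mul_le_lqNorm_mul_lqNorm {p : ℝ≥0∞} (hpq : p.HolderConjugate q) (a b : ℕ → ℝ≥0∞) :
    ∑' k, a k * b k ≤ lqNorm p a * lqNorm q b := by
  wlog hp : p ≠ ∞ generalizing p q a b
  · obtain rfl : p = ∞ := not_ne_iff.1 hp
    obtain rfl : q = 1 := by simpa using hpq.conj_eq
    simpa only [mul_comm] using this hpq.symm b a ENNReal.one_ne_top
  obtain rfl | hq := eq_or_ne q ∞
  · obtain rfl : p = 1 := by simpa using hpq.symm.conj_eq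
    rw [lqNorm_top, lqNorm_of_ne_top ENNReal.one_ne_top, ENNReal.toReal_one, div_one,
      ENNReal.rpow_one, ← ENNReal.tsum_mul_right]
    simp only [ENNReal.rpow_one]
    gcongr with k
    exact le_iSup b k
  · have hpq' : p.toReal.HolderConjugate q.toReal :=
      haveI := hpq; ENNReal.HolderConjugate.toReal_of_ne_top hp hq
    rw [lqNorm_of_ne_top hp, lqNorm_of_ne_top hq]
    simpa only [lintegral_count, Pi.mul_apply] using
      ENNReal.lintegral_mul_le_Lp_mul_Lq (f := a) (g := b) Measure.count hpq'
        Measurable.of_discrete.aemeasurable Measurable.of_discrete.aemeasurable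

lemma holderConst_eq_lqNorm (t : ℝ) (hq : 1 ≤ q) (b : ℕ → ℝ≥0∞) :
    holderConst t q b = lqNorm q.conjExponent fun k => b k ^ (1 / t) := by
  unfold holderConst
  split_ifs with h
  · subst h
    simp [ENNReal.conjExponent, lqNorm_top]
  · have hq' : q.conjExponent ≠ ∞ := by
      simpa [ENNReal.conjExponent, tsub_eq_zero_iff_le] using lt_of_le_of_ne hq (Ne.symm h)
    simp only [lqNorm_of_ne_top hq', ← ENNReal.rpow_mul, one_div_mul_eq_div]

end lqNorm

section lpSum

variable {ι : Type*} {p : ℝ} (F : Finset ι)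

lemma lpSum_mono (hp : 0 ≤ p) {a b : ι → ℝ≥0∞} (h : ∀ i ∈ F, a i ≤ b i) :
    lpSum p F a ≤ lpSum p F b := by
  unfold lpSum
  gcongr with i hi
  exact h i hi

lemma lpSum_add_le (hp : 1 ≤ p) (a b : ι → ℝ≥0∞) :
    lpSum p F (fun i => a i + b i) ≤ lpSum p F a + lpSum p F b :=
  ENNReal.Lp_add_le F a b hp

lemma lpSum_const_mul (hp : 0 < p) (c : ℝ≥0∞) (a : ι → ℝ≥0∞) :
    lpSum p F (fun i => c * a i) = c * lpSum p F a := by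
  simp_rw [lpSum, ENNReal.mul_rpow_of_nonneg _ _ hp.le, ← Finset.mul_sum]
  rw [ENNReal.mul_rpow_of_nonneg _ _ (by positivity), one_div, ENNReal.rpow_rpow_inv hp.ne']

lemma lpSum_le_sum (hp : 1 ≤ p) (a : ι → ℝ≥0∞) : lpSum p F a ≤ ∑ i ∈ F, a i := by
  classical
  rw [lpSum, one_div, ENNReal.rpow_inv_le_iff (one_pos.trans_le hp)]
  induction F using Finset.induction_on with
  | empty => simp only [Finset.sum_empty, zero_le]
  | insert i F hi ih =>
    rw [Finset.sum_insert hi, Finset.sum_insert hi]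
    exact (add_le_add_right ih _).trans (ENNReal.add_rpow_le_rpow_add _ _ hp)

lemma sum_mul_le_sum_mul_lpSum (hp : 0 < p) (w a : ι → ℝ≥0∞) :
    ∑ i ∈ F, w i * a i ≤ (∑ i ∈ F, w i) * lpSum p F a := by
  rw [Finset.sum_mul]
  gcongr with i hi
  rw [lpSum, one_div, ENNReal.le_rpow_inv_iff hp]
  exact Finset.single_le_sum (f := fun i => a i ^ p) (fun _ _ => zero_le) hi

end lpSum

section MixedNorm

variable {q : ℝ≥0∞} {p : ℝ} {ι : Type*} {F : ℕ → Finset ι} {a b c : ℕ → ι → ℝ≥0∞}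

lemma lqNorm_lpSum_le_add (hq : 1 ≤ q) (hp : 1 ≤ p) (h : ∀ k, ∀ i ∈ F k, a k i ≤ b k i + c k i) :
    lqNorm q (fun k => lpSum p (F k) (a k)) ≤
      lqNorm q (fun k => lpSum p (F k) (b k)) + lqNorm q fun k => lpSum p (F k) (c k) :=
  (lqNorm_mono fun k => (lpSum_mono _ (zero_le_one.trans hp) (h k)).trans
    (lpSum_add_le _ hp _ _)).trans (lqNorm_add_le hq _ _)

lemma lqNorm_lpSum_le_mul (hq : q ≠ 0) (hp : 0 < p) {z : ℝ≥0∞}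
    (h : ∀ k, ∀ i ∈ F k, a k i ≤ z * b k i) :
    lqNorm q (fun k => lpSum p (F k) (a k)) ≤ z * lqNorm q fun k => lpSum p (F k) (b k) := by
  rw [← lqNorm_const_mul hq]
  exact lqNorm_mono fun k => (lpSum_mono _ hp.le (h k)).trans_eq (lpSum_const_mul _ hp _ _)

end MixedNorm

/-! ### Repeated halving of finite families -/

/-- `order` lists the elements of every finite set, without repetitions. -/
structure IsEnumeration {α : Type*} (order : Finset α → List α) : Prop where
  nodup : ∀ T, (order T).Nodup
  mem_iff : ∀ T P, P ∈ order T ↔ P ∈ T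

open Classical in
/-- The pairs obtained from `T` by repeated halving. There are none if `T` has fewer than two
elements, a case that `haarPairs` does not single out. -/
def splitPairs {α : Type*} (order : Finset α → List α) (T : Finset α) :
    Finset (Finset α × Finset α) :=
  if 2 ≤ T.card then haarPairs order T else ∅

open Classical in
/-- The half of `T` that contains a given element `P` of `T`. -/
def halfContaining {α : Type*} (order : Finset α → List α) (T : Finset α) (P : α) : Finset α :=
  if P ∈ (halves order T).1 then (halves order T).1 else (halves order T).2

section Halving

variable {α : Type*} {order : Finset α → List α}

lemma splitPairs_of_two_le {T : Finset α} (hT : 2 ≤ T.card) :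
    splitPairs order T = haarPairs order T := if_pos hT

lemma splitPairs_singleton (P : α) : splitPairs order {P} = ∅ := by simp [splitPairs]

lemma mem_haarGen_succ (T : Finset α) (j : ℕ) (S : Finset α × Finset α) :
    S ∈ haarGen order T (j + 1) ↔
      (2 ≤ (halves order T).1.card ∧ S ∈ haarGen order (halves order T).1 j) ∨
      (2 ≤ (halves order T).2.card ∧ S ∈ haarGen order (halves order T).2 j) := by
  classical
  induction j generalizing S with
  | zero =>
    simp only [haarGen, Finset.mem_biUnion, Finset.mem_image, Finset.mem_filter,
      Finset.mem_insert, Finset.mem_singleton]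
    grind
  | succ j ih =>
    rw [haarGen]
    simp only [Finset.mem_biUnion, ih]
    simp only [haarGen, Finset.mem_biUnion]
    grind

namespace IsEnumeration

variable (ho : IsEnumeration order) {T : Finset α} {P : α}

include ho

open Classical in
lemma halves_union (T : Finset α) : (halves order T).1 ∪ (halves order T).2 = T := by
  ext P
  rw [halves, ← List.toFinset_append, List.take_append_drop, List.mem_toFinset, ho.mem_iff]

lemma halves_disjoint (T : Finset α) : Disjoint (halves order T).1 (halves order T).2 := by
  classical
  have h := ho.nodup T
  rw [← List.take_append_drop (T.card / 2) (order T), List.nodup_append'] at h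
  exact List.disjoint_toFinset_iff_disjoint.2 h.2.2

lemma halves_fst_subset (T : Finset α) : (halves order T).1 ⊆ T := by
  classical exact Finset.subset_union_left.trans_eq (ho.halves_union T)

lemma halves_snd_subset (T : Finset α) : (halves order T).2 ⊆ T := by
  classical exact Finset.subset_union_right.trans_eq (ho.halves_union T)

lemma halves_fst_nonempty (hT : 2 ≤ T.card) : (halves order T).1.Nonempty :=
  Finset.card_pos.1 (by have := card_halves order ho.nodup ho.mem_iff T; omega)

lemma halves_snd_nonempty (hT : 2 ≤ T.card) : (halves order T).2.Nonempty :=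
  Finset.card_pos.1 (by have := card_halves order ho.nodup ho.mem_iff T; omega)

lemma sum_halves {M : Type*} [AddCommMonoid M] (f : α → M) (T : Finset α) :
    ∑ R ∈ (halves order T).1, f R + ∑ R ∈ (halves order T).2, f R = ∑ R ∈ T, f R := by
  classical rw [← Finset.sum_union (ho.halves_disjoint T), ho.halves_union]

lemma mem_halfContaining (hP : P ∈ T) : P ∈ halfContaining order T P := by
  classical
  rw [← ho.halves_union T, Finset.mem_union] at hP
  unfold halfContaining
  split_ifs with h
  exacts [h, hP.resolve_left h]

lemma halfContaining_subset (T : Finset α) (P : α) : halfContaining order T P ⊆ T := by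
  unfold halfContaining
  split_ifs
  exacts [ho.halves_fst_subset T, ho.halves_snd_subset T]

lemma card_halfContaining_le (T : Finset α) (P : α) :
    (halfContaining order T P).card ≤ (T.card + 1) / 2 := by
  have := card_halves order ho.nodup ho.mem_iff T
  unfold halfContaining
  split_ifs <;> omega

lemma halfContaining_induction {motive : ∀ T : Finset α, P ∈ T → Prop}
    (singleton : motive {P} (Finset.mem_singleton_self P))
    (step : ∀ T (hP : P ∈ T), 2 ≤ T.card →
      motive (halfContaining order T P) (ho.mem_halfContaining hP) → motive T hP)
    (T : Finset α) (hP : P ∈ T) : motive T hP := by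
  induction T using Finset.strongInduction with
  | H T ih =>
    by_cases hT : 2 ≤ T.card
    · refine step T hP hT (ih _ ?_ _)
      refine (ho.halfContaining_subset T P).ssubset_of_ne fun h => ?_
      have := h ▸ ho.card_halfContaining_le T P
      omega
    · have := Finset.card_pos.2 ⟨P, hP⟩
      obtain ⟨R, rfl⟩ := Finset.card_eq_one.1 (by omega : T.card = 1)
      obtain rfl := Finset.mem_singleton.1 hP
      exact singleton

lemma mem_splitPairs (T : Finset α) (S : Finset α × Finset α) :
    S ∈ splitPairs order T ↔ 2 ≤ T.card ∧ ∃ j, S ∈ haarGen order T j := by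
  unfold splitPairs
  split_ifs with hT
  · simp only [mem_haarPairs order ho.nodup ho.mem_iff T hT, hT, true_and]
  · simp only [Finset.notMem_empty, hT, false_and]

lemma mem_splitPairs_iff (hT : 2 ≤ T.card) (S : Finset α × Finset α) :
    S ∈ splitPairs order T ↔ S = halves order T ∨ S ∈ splitPairs order (halves order T).1 ∨
      S ∈ splitPairs order (halves order T).2 := by
  have generation_zero : S ∈ haarGen order T 0 ↔ S = halves order T := Finset.mem_singleton
  simp only [ho.mem_splitPairs, hT, true_and, ← generation_zero]
  constructor
  · rintro ⟨_ | j, hj⟩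
    · exact .inl hj
    · exact .inr (((mem_haarGen_succ T j S).1 hj).imp (fun h => ⟨h.1, j, h.2⟩)
        fun h => ⟨h.1, j, h.2⟩)
  · rintro (h | ⟨hc, j, hj⟩ | ⟨hc, j, hj⟩)
    · exact ⟨0, h⟩
    · exact ⟨j + 1, (mem_haarGen_succ T j S).2 (.inl ⟨hc, hj⟩)⟩
    · exact ⟨j + 1, (mem_haarGen_succ T j S).2 (.inr ⟨hc, hj⟩)⟩

lemma exists_eq_halves {S : Finset α × Finset α} (hS : S ∈ splitPairs order T) :
    ∃ R ⊆ T, 2 ≤ R.card ∧ S = halves order R := by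
  classical
  obtain ⟨hT, j, hj⟩ := (ho.mem_splitPairs T S).1 hS
  clear hS
  induction j generalizing S with
  | zero => exact ⟨T, subset_rfl, hT, Finset.mem_singleton.1 hj⟩
  | succ j ih =>
    simp only [haarGen, Finset.mem_biUnion, Finset.mem_image, Finset.mem_filter,
      Finset.mem_insert, Finset.mem_singleton] at hj
    obtain ⟨S, hS, R, ⟨hR, hc⟩, rfl⟩ := hj
    obtain ⟨R', hR', -, rfl⟩ := ih hS
    refine ⟨R, ?_, hc, rfl⟩
    rcases hR with rfl | rfl
    exacts [(ho.halves_fst_subset R').trans hR', (ho.halves_snd_subset R').trans hR']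

lemma halves_notMem_splitPairs_halfContaining (hT : 2 ≤ T.card) (P : α) :
    halves order T ∉ splitPairs order (halfContaining order T P) := fun h => by
  classical
  obtain ⟨R, hR, -, hTR⟩ := ho.exists_eq_halves h
  obtain rfl : R = T := by rw [← ho.halves_union R, ← hTR, ho.halves_union]
  have := (Finset.card_le_card hR).trans (ho.card_halfContaining_le R P)
  omega

/-- `P` lies in one half of `T` only, so the pairs obtained from the other half do not
contribute. -/
lemma sum_splitPairs {M : Type*} [AddCommMonoid M] (hT : 2 ≤ T.card)
    {F : Finset α × Finset α → M} (hF : ∀ S, P ∉ S.1 → P ∉ S.2 → F S = 0) :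
    ∑ S ∈ splitPairs order T, F S =
      F (halves order T) + ∑ S ∈ splitPairs order (halfContaining order T P), F S := by
  classical
  rw [← Finset.sum_insert (ho.halves_notMem_splitPairs_halfContaining hT P)]
  refine (Finset.sum_subset (fun S hS => ?_) fun S hS hS' => ?_).symm
  · rw [ho.mem_splitPairs_iff hT]
    refine (Finset.mem_insert.1 hS).imp_right fun h => ?_
    unfold halfContaining at h
    split_ifs at h
    exacts [.inl h, .inr h]
  · rw [Finset.mem_insert, not_or] at hS'
    have unseen : ∀ R, P ∉ R → S ∈ splitPairs order R → F S = 0 := fun R hPR hSR => by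
      obtain ⟨R', hR', -, rfl⟩ := ho.exists_eq_halves hSR
      exact hF _ (fun h => hPR (hR' (ho.halves_fst_subset R' h)))
        fun h => hPR (hR' (ho.halves_snd_subset R' h))
    have hP : P ∈ (halves order T).1 → P ∉ (halves order T).2 :=
      fun h => Finset.disjoint_left.1 (ho.halves_disjoint T) h
    have hS'' := ((ho.mem_splitPairs_iff hT S).1 hS).resolve_left hS'.1
    unfold halfContaining at hS'
    split_ifs at hS' with h
    · exact unseen _ (hP h) (hS''.resolve_left hS'.2)
    · exact unseen _ h (hS''.resolve_right hS'.2)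

open Classical in
lemma card_splitPairs_filter_mem_le (hP : P ∈ T) :
    {S ∈ splitPairs order T | P ∈ S.1 ∨ P ∈ S.2}.card ≤ Nat.clog 2 T.card := by
  simp only [Finset.card_filter]
  induction T, hP using ho.halfContaining_induction with
  | singleton => simp [splitPairs_singleton]
  | step T hP hT ih =>
    rw [ho.sum_splitPairs (P := P) hT fun S h₁ h₂ => if_neg (not_or.2 ⟨h₁, h₂⟩),
      Nat.clog_of_two_le one_lt_two hT, add_comm]
    gcongr
    · exact ih.trans (Nat.clog_mono_right 2 (by have := ho.card_halfContaining_le T P; omega))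
    · split_ifs <;> simp

end IsEnumeration

end Halving

/-! ### Discrete Haar expansions -/

section DiscreteHaar

variable {α E : Type*} [AddCommGroup E] [Module ℝ E]

/-- The normalizing factor of the Haar wavelet of a pair of sets of measures `a` and `b`. -/
def haarFactor (a b : ℝ) : ℝ := 1 / (1 / a + 1 / b) ^ (1 / 2 : ℝ)

/-- The average over a family of cells of weights `w` of a function whose integrals over the cells
are `A`. -/
def cellMean (w : α → ℝ) (A : α → E) (T : Finset α) : E := (∑ R ∈ T, w R)⁻¹ • ∑ R ∈ T, A R

/-- The Haar coefficient for `S` of a function whose integrals over the cells are `A`. -/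
def discreteHaarCoeff (w : α → ℝ) (A : α → E) (S : Finset α × Finset α) : E :=
  haarFactor (∑ R ∈ S.1, w R) (∑ R ∈ S.2, w R) • (cellMean w A S.1 - cellMean w A S.2)

open Classical in
/-- The value on the cell `P` of the Haar wavelet of `S`, for cells of weights `w`. -/
def discreteHaar (w : α → ℝ) (S : Finset α × Finset α) (P : α) : ℝ :=
  haarFactor (∑ R ∈ S.1, w R) (∑ R ∈ S.2, w R) *
    ((if P ∈ S.1 then 1 else 0) / (∑ R ∈ S.1, w R) - (if P ∈ S.2 then 1 else 0) / (∑ R ∈ S.2, w R))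

lemma haarFactor_comm (a b : ℝ) : haarFactor a b = haarFactor b a := by
  rw [haarFactor, haarFactor, add_comm]

lemma haarFactor_sq {a b : ℝ} (ha : 0 < a) (hb : 0 < b) :
    haarFactor a b ^ 2 = a * b / (a + b) := by
  rw [haarFactor, ← Real.sqrt_eq_rpow, div_pow, Real.sq_sqrt (by positivity)]
  field_simp
  ring

lemma haarFactor_smul_sub_smul {a b : ℝ} (ha : 0 < a) (hb : 0 < b) (x y : E) :
    (haarFactor a b * (1 / a)) • haarFactor a b • (a⁻¹ • x - b⁻¹ • y) =
      a⁻¹ • x - (a + b)⁻¹ • (x + y) := by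
  rw [smul_smul, show haarFactor a b * (1 / a) * haarFactor a b = haarFactor a b ^ 2 / a by ring,
    haarFactor_sq ha hb]
  match_scalars <;> field_simp
  ring

lemma discreteHaar_eq_zero (w : α → ℝ) {S : Finset α × Finset α} {P : α} (h₁ : P ∉ S.1)
    (h₂ : P ∉ S.2) : discreteHaar w S P = 0 := by
  simp [discreteHaar, h₁, h₂]

open Classical in
lemma discreteHaarCoeff_single (w : α → ℝ) (P : α) :
    (discreteHaarCoeff w (Pi.single P 1) : Finset α × Finset α → ℝ) =
      fun S => discreteHaar w S P := by
  funext S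
  simp only [discreteHaarCoeff, discreteHaar, cellMean, Finset.sum_pi_single', smul_eq_mul,
    inv_mul_eq_div]

lemma discreteHaarCoeff_eq_sum (w : α → ℝ) (A : α → E) {S : Finset α × Finset α} {T : Finset α}
    (h₁ : S.1 ⊆ T) (h₂ : S.2 ⊆ T) :
    discreteHaarCoeff w A S = ∑ P ∈ T, discreteHaar w S P • A P := by
  classical
  have mean_eq {R : Finset α} (hR : R ⊆ T) :
      cellMean w A R = ∑ P ∈ T, ((if P ∈ R then 1 else 0) / ∑ P ∈ R, w P) • A P := by
    simp_rw [cellMean, div_eq_inv_mul, mul_smul, ← Finset.smul_sum, ite_smul, one_smul, zero_smul]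
    rw [Finset.sum_ite_mem, Finset.inter_eq_right.2 hR]
  rw [discreteHaarCoeff, mean_eq h₁, mean_eq h₂, ← Finset.sum_sub_distrib, Finset.smul_sum]
  simp only [discreteHaar, mul_smul, sub_smul]

lemma discreteHaarCoeff_sub_smul {w : α → ℝ} {S : Finset α × Finset α} (h₁ : ∑ R ∈ S.1, w R ≠ 0)
    (h₂ : ∑ R ∈ S.2, w R ≠ 0) (A : α → E) (c : E) :
    discreteHaarCoeff w (fun R => A R - w R • c) S = discreteHaarCoeff w A S := by
  have mean_sub {T : Finset α} (hT : ∑ R ∈ T, w R ≠ 0) :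
      cellMean w (fun R => A R - w R • c) T = cellMean w A T - c := by
    rw [cellMean, cellMean, Finset.sum_sub_distrib, ← Finset.sum_smul, smul_sub, smul_smul,
      inv_mul_cancel₀ hT, one_smul]
  rw [discreteHaarCoeff, discreteHaarCoeff, mean_sub h₁, mean_sub h₂, sub_sub_sub_cancel_right]

variable {order : Finset α → List α} (ho : IsEnumeration order) {w : α → ℝ} {T : Finset α} {P : α}

include ho

lemma discreteHaar_smul_discreteHaarCoeff_halves (A : α → E) (hw : ∀ R ∈ T, 0 < w R)
    (hT : 2 ≤ T.card) (hP : P ∈ T) :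
    discreteHaar w (halves order T) P • discreteHaarCoeff w A (halves order T) =
      cellMean w A (halfContaining order T P) - cellMean w A T := by
  have h₁ : 0 < ∑ R ∈ (halves order T).1, w R :=
    Finset.sum_pos (fun R hR => hw R (ho.halves_fst_subset T hR)) (ho.halves_fst_nonempty hT)
  have h₂ : 0 < ∑ R ∈ (halves order T).2, w R :=
    Finset.sum_pos (fun R hR => hw R (ho.halves_snd_subset T hR)) (ho.halves_snd_nonempty hT)
  have hPd : P ∈ (halves order T).1 → P ∉ (halves order T).2 :=
    fun h => Finset.disjoint_left.1 (ho.halves_disjoint T) h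
  have hPmem := ho.mem_halfContaining hP
  unfold discreteHaar discreteHaarCoeff
  unfold halfContaining at hPmem ⊢
  simp only [cellMean, ← ho.sum_halves _ T]
  split_ifs at hPmem ⊢ with hP₁ hP₂
  · exact absurd hP₂ (hPd hP₁)
  · rw [zero_div, sub_zero, haarFactor_smul_sub_smul h₁ h₂]
  · rw [zero_div, zero_sub, add_comm (∑ R ∈ (halves order T).1, w R),
      add_comm (∑ R ∈ (halves order T).1, A R), ← haarFactor_smul_sub_smul h₂ h₁,
      haarFactor_comm (∑ R ∈ (halves order T).1, w R), mul_neg, neg_smul, ← smul_neg, ← smul_neg,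
      neg_sub]

/-- The terms telescope along the decreasing chain of halves that contain `P`. -/
theorem sum_discreteHaar_smul_discreteHaarCoeff (A : α → E) (hw : ∀ R ∈ T, 0 < w R) (hP : P ∈ T) :
    ∑ S ∈ splitPairs order T, discreteHaar w S P • discreteHaarCoeff w A S =
      (w P)⁻¹ • A P - cellMean w A T := by
  induction T, hP using ho.halfContaining_induction with
  | singleton => simp [splitPairs_singleton, cellMean]
  | step T hP hT ih =>
    have unseen : ∀ S : Finset α × Finset α, P ∉ S.1 → P ∉ S.2 →
        discreteHaar w S P • discreteHaarCoeff w A S = 0 := fun S h₁ h₂ => by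
      rw [discreteHaar_eq_zero w h₁ h₂, zero_smul]
    rw [ho.sum_splitPairs hT unseen, ih fun R hR => hw R (ho.halfContaining_subset T P hR),
      discreteHaar_smul_discreteHaarCoeff_halves ho A hw hT hP]
    abel

lemma sum_discreteHaar_sq (hw : ∀ R ∈ T, 0 < w R) (hP : P ∈ T) :
    ∑ S ∈ splitPairs order T, discreteHaar w S P ^ 2 = (w P)⁻¹ - (∑ R ∈ T, w R)⁻¹ := by
  classical
  have h := sum_discreteHaar_smul_discreteHaarCoeff ho (Pi.single P (1 : ℝ)) hw hP
  simpa only [discreteHaarCoeff_single, smul_eq_mul, ← sq, cellMean, Finset.sum_pi_single', hP,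
    if_true, Pi.single_eq_same, mul_one] using h

lemma sum_abs_discreteHaar_sq_le (hw : ∀ R ∈ T, 0 < w R) (hP : P ∈ T) :
    (∑ S ∈ splitPairs order T, |discreteHaar w S P|) ^ 2 ≤ Nat.clog 2 T.card * (w P)⁻¹ := by
  classical
  have seen : ∑ S ∈ splitPairs order T, |discreteHaar w S P| =
      ∑ S ∈ splitPairs order T with P ∈ S.1 ∨ P ∈ S.2, |discreteHaar w S P| :=
    (Finset.sum_filter_of_ne fun S _ h => by
      contrapose! h
      rw [discreteHaar_eq_zero w h.1 h.2, abs_zero]).symm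
  have sum_sq : ∑ S ∈ splitPairs order T with P ∈ S.1 ∨ P ∈ S.2, |discreteHaar w S P| ^ 2 ≤
      (w P)⁻¹ := by
    simp only [sq_abs]
    refine (Finset.sum_le_sum_of_subset_of_nonneg (Finset.filter_subset _ _)
      fun _ _ _ => sq_nonneg _).trans ?_
    rw [sum_discreteHaar_sq ho hw hP]
    exact sub_le_self _ (inv_nonneg.2 (Finset.sum_nonneg fun R hR => (hw R hR).le))
  rw [seen]
  refine sq_sum_le_card_mul_sum_sq.trans ?_
  gcongr
  exact ho.card_splitPairs_filter_mem_le hP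

end DiscreteHaar

/-! ### Geometry of good grids -/

variable {I : Type*} [MeasurableSpace I] {m : Measure I} {G : Grid m} {l₁ l₂ : ℝ}

namespace Grid

open Classical in
/-- The cells of level `k` contained in `Q`; for `Q` of level `k - 1` these are its children. -/
def descendants (G : Grid m) (k : ℕ) (Q : Set I) : Finset (Set I) := {P ∈ G.cells k | P ⊆ Q}

lemma mem_descendants {k : ℕ} {Q P : Set I} :
    P ∈ G.descendants k Q ↔ P ∈ G.cells k ∧ P ⊆ Q := by
  simp [descendants]

lemma mem_children {k : ℕ} {Q P : Set I} :
    P ∈ G.children k Q ↔ P ∈ G.cells (k + 1) ∧ P ⊆ Q := mem_descendants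

lemma descendants_univ (k : ℕ) : G.descendants k Set.univ = G.cells k := by
  simp [descendants]

lemma nonempty_of_mem_cells {k : ℕ} {Q : Set I} (hQ : Q ∈ G.cells k) : Q.Nonempty :=
  nonempty_of_measure_ne_zero (G.measure_pos k Q hQ).ne'

lemma measureReal_pos [IsFiniteMeasure m] {k : ℕ} {Q : Set I} (hQ : Q ∈ G.cells k) :
    0 < m.real Q := ENNReal.toReal_pos (G.measure_pos k Q hQ).ne' (measure_ne_top _ _)

lemma measurableSet_of_mem_descendants {k : ℕ} {Q : Set I} :
    ∀ P ∈ G.descendants k Q, MeasurableSet P :=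
  fun P hP => G.measurableSet_of_mem k P (mem_descendants.1 hP).1

namespace IsGood

variable (hG : G.IsGood l₁ l₂)

include hG

lemma l₂_pos : 0 < l₂ := hG.pos.trans hG.lt

lemma univ_mem : Set.univ ∈ G.cells 0 := hG.cells_zero ▸ Finset.mem_singleton_self _

lemma measure_univ_pos : 0 < m Set.univ := G.measure_pos 0 _ hG.univ_mem

lemma eq_of_mem {k : ℕ} {P Q : Set I} (hP : P ∈ G.cells k) (hQ : Q ∈ G.cells k) {x : I}
    (hxP : x ∈ P) (hxQ : x ∈ Q) : P = Q := by
  by_contra h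
  exact Set.disjoint_left.1 (hG.disjoint k P hP Q hQ h) hxP hxQ

lemma exists_ancestor (k i : ℕ) {Q : Set I} (hQ : Q ∈ G.cells (k + i)) :
    ∃ P ∈ G.cells k, Q ⊆ P := by
  induction i generalizing Q with
  | zero => exact ⟨Q, hQ, subset_rfl⟩
  | succ i ih =>
    obtain ⟨R, hR, hQR⟩ := hG.exists_parent (k + i) Q hQ
    obtain ⟨P, hP, hRP⟩ := ih hR
    exact ⟨P, hP, hQR.trans hRP⟩

lemma subset_of_mem {j k : ℕ} (hjk : j ≤ k) {P Q : Set I} (hP : P ∈ G.cells j)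
    (hQ : Q ∈ G.cells k) {x : I} (hxP : x ∈ P) (hxQ : x ∈ Q) : Q ⊆ P := by
  obtain ⟨i, rfl⟩ := Nat.exists_eq_add_of_le hjk
  obtain ⟨R, hR, hQR⟩ := hG.exists_ancestor j i hQ
  rwa [hG.eq_of_mem hP hR hxP (hQR hxQ)]

lemma pairwiseDisjoint_descendants (k : ℕ) (Q : Set I) :
    Set.PairwiseDisjoint (↑(G.descendants k Q)) (fun P : Set I => P) := fun P hP R hR h =>
  hG.disjoint k P (mem_descendants.1 hP).1 R (mem_descendants.1 hR).1 h

lemma ae_eq_biUnion_descendants {j k : ℕ} (hjk : j ≤ k) {Q : Set I} (hQ : Q ∈ G.cells j) :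
    Q =ᵐ[m] ⋃ P ∈ G.descendants k Q, P := by
  have hsub : (⋃ P ∈ G.descendants k Q, P) ⊆ Q :=
    Set.iUnion₂_subset fun P hP => (mem_descendants.1 hP).2
  refine EventuallyLE.antisymm (ae_le_set.2 (measure_mono_null ?_ (hG.cover k))) hsub.eventuallyLE
  rintro x ⟨hxQ, hx⟩ hxU
  simp only [Set.mem_iUnion, exists_prop] at hxU hx
  obtain ⟨R, hR, hxR⟩ := hxU
  exact hx ⟨R, mem_descendants.2 ⟨hR, hG.subset_of_mem hjk hQ hR hxQ hxR⟩, hxR⟩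

lemma setLIntegral_eq_sum {j k : ℕ} (hjk : j ≤ k) {Q : Set I} (hQ : Q ∈ G.cells j)
    (f : I → ℝ≥0∞) : ∫⁻ x in Q, f x ∂m = ∑ P ∈ G.descendants k Q, ∫⁻ x in P, f x ∂m := by
  rw [setLIntegral_congr (hG.ae_eq_biUnion_descendants hjk hQ),
    lintegral_biUnion_finset (hG.pairwiseDisjoint_descendants k Q) measurableSet_of_mem_descendants]

lemma setIntegral_eq_sum {j k : ℕ} (hjk : j ≤ k) {Q : Set I} (hQ : Q ∈ G.cells j)
    {E : Type*} [NormedAddCommGroup E] [NormedSpace ℝ E] {f : I → E} (hf : Integrable f m) :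
    ∫ x in Q, f x ∂m = ∑ P ∈ G.descendants k Q, ∫ x in P, f x ∂m := by
  rw [setIntegral_congr_set (hG.ae_eq_biUnion_descendants hjk hQ),
    integral_biUnion_finset _ measurableSet_of_mem_descendants (hG.pairwiseDisjoint_descendants k Q)
      fun P _ => hf.integrableOn]

lemma overlap_eq_one : G.overlap = 1 := by
  have meets_iff : ∀ k, ∀ Q ∈ G.cells k,
      {P ∈ (G.cells k : Set (Set I)) | (P ∩ Q).Nonempty} = {Q} := fun k Q hQ => by
    ext P
    refine ⟨fun ⟨hP, x, hxP, hxQ⟩ => hG.eq_of_mem hP hQ hxP hxQ, ?_⟩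
    rintro rfl
    exact ⟨hQ, by simpa using nonempty_of_mem_cells hQ⟩
  refine le_antisymm (iSup_le fun k => iSup₂_le fun Q hQ => by rw [meets_iff k Q hQ]; simp)
    (le_iSup_of_le 0 (le_iSup₂_of_le Set.univ hG.univ_mem ?_))
  rw [meets_iff 0 _ hG.univ_mem]
  simp

variable [IsFiniteMeasure m]

lemma measureReal_eq_sum {j k : ℕ} (hjk : j ≤ k) {Q : Set I}
    (hQ : Q ∈ G.cells j) : m.real Q = ∑ P ∈ G.descendants k Q, m.real P := by
  rw [measureReal_congr (hG.ae_eq_biUnion_descendants hjk hQ),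
    measureReal_biUnion_finset (hG.pairwiseDisjoint_descendants k Q)
      measurableSet_of_mem_descendants]

lemma totalMeasure_children {k : ℕ} {Q : Set I} (hQ : Q ∈ G.cells k) :
    totalMeasure m (G.children k Q) = m.real Q :=
  (hG.measureReal_eq_sum (Nat.le_succ k) hQ).symm

lemma mul_measureReal_le_of_mem_children {k : ℕ} {Q P : Set I} (hQ : Q ∈ G.cells k)
    (hP : P ∈ G.children k Q) : l₁ * m.real Q ≤ m.real P :=
  have ⟨hPk, hPQ⟩ := mem_children.1 hP
  (le_div_iff₀ (measureReal_pos hQ)).1 (hG.ratio k P hPk Q hQ hPQ).1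

lemma measureReal_le_of_mem_children {k : ℕ} {Q P : Set I} (hQ : Q ∈ G.cells k)
    (hP : P ∈ G.children k Q) : m.real P ≤ l₂ * m.real Q :=
  have ⟨hPk, hPQ⟩ := mem_children.1 hP
  (div_le_iff₀ (measureReal_pos hQ)).1 (hG.ratio k P hPk Q hQ hPQ).2

lemma measure_le_of_mem_children {k : ℕ} {Q P : Set I} (hQ : Q ∈ G.cells k)
    (hP : P ∈ G.children k Q) : m P ≤ ENNReal.ofReal l₂ * m Q := by
  rw [← ofReal_measureReal (measure_ne_top m P), ← ofReal_measureReal (measure_ne_top m Q),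
    ← ENNReal.ofReal_mul hG.l₂_pos.le]
  exact ENNReal.ofReal_le_ofReal (hG.measureReal_le_of_mem_children hQ hP)

lemma measure_le_pow_mul (k i : ℕ) {P Q : Set I} (hP : P ∈ G.cells k)
    (hQ : Q ∈ G.cells (k + i)) (h : Q ⊆ P) : m Q ≤ ENNReal.ofReal l₂ ^ i * m P := by
  induction i generalizing Q with
  | zero => simpa using measure_mono h
  | succ i ih =>
    obtain ⟨R, hR, hQR⟩ := hG.exists_parent (k + i) Q hQ
    obtain ⟨x, hx⟩ := nonempty_of_mem_cells hQ
    have hRP : R ⊆ P := hG.subset_of_mem (Nat.le_add_right k i) hP hR (h hx) (hQR hx)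
    calc m Q ≤ ENNReal.ofReal l₂ * m R :=
          hG.measure_le_of_mem_children hR (mem_children.2 ⟨hQ, hQR⟩)
      _ ≤ ENNReal.ofReal l₂ * (ENNReal.ofReal l₂ ^ i * m P) := by gcongr; exact ih hR hRP
      _ = ENNReal.ofReal l₂ ^ (i + 1) * m P := by ring

lemma one_le_card_children_mul {k : ℕ} {Q : Set I} (hQ : Q ∈ G.cells k) :
    1 ≤ (G.children k Q).card * l₂ := by
  have h := Finset.sum_le_card_nsmul _ m.real _ fun P hP => hG.measureReal_le_of_mem_children hQ hP
  rw [← totalMeasure, hG.totalMeasure_children hQ, nsmul_eq_mul, ← mul_assoc] at h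
  exact (le_mul_iff_one_le_left (measureReal_pos hQ)).1 h

lemma card_children_mul_le_one {k : ℕ} {Q : Set I} (hQ : Q ∈ G.cells k) :
    (G.children k Q).card * l₁ ≤ 1 := by
  have h := Finset.card_nsmul_le_sum _ m.real _
    fun P hP => hG.mul_measureReal_le_of_mem_children hQ hP
  rw [← totalMeasure, hG.totalMeasure_children hQ, nsmul_eq_mul, ← mul_assoc] at h
  exact (mul_le_iff_le_one_left (measureReal_pos hQ)).1 h

lemma two_le_card_children {k : ℕ} {Q : Set I} (hQ : Q ∈ G.cells k) :
    2 ≤ (G.children k Q).card := by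
  by_contra! hc
  have hc' : ((G.children k Q).card : ℝ) ≤ 1 := by exact_mod_cast Nat.lt_succ_iff.1 hc
  nlinarith [hG.one_le_card_children_mul hQ, hG.l₂_pos, hG.lt_one]

lemma haarFamily_eq_splitPairs (D : G.Choices) {k : ℕ} {Q : Set I} (hQ : Q ∈ G.cells k) :
    G.haarFamily D k Q = splitPairs D.order (G.children k Q) :=
  (splitPairs_of_two_le (hG.two_le_card_children hQ)).symm

lemma mesh_le (k : ℕ) : G.mesh k ≤ ENNReal.ofReal l₂ ^ k * m Set.univ :=
  iSup₂_le fun Q hQ =>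
    hG.measure_le_pow_mul 0 k hG.univ_mem (by rwa [zero_add]) (Set.subset_univ Q)

omit [IsFiniteMeasure m] in
lemma ofReal_l₂_rpow_lt_one {s : ℝ} (hs : 0 < s) : ENNReal.ofReal l₂ ^ s < 1 :=
  ENNReal.rpow_lt_one (by simpa using hG.lt_one) hs

lemma lqNorm_mesh_rpow_lt_top {q : ℝ≥0∞} (hq : q ≠ 0) {s : ℝ} (hs : 0 < s) :
    lqNorm q (fun k => G.mesh k ^ s) < ∞ := by
  have mesh_rpow_le (k : ℕ) : G.mesh k ^ s ≤ m Set.univ ^ s * (ENNReal.ofReal l₂ ^ s) ^ k := by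
    calc G.mesh k ^ s ≤ (ENNReal.ofReal l₂ ^ k * m Set.univ) ^ s := by gcongr; exact hG.mesh_le k
      _ = m Set.univ ^ s * (ENNReal.ofReal l₂ ^ s) ^ k := by
        rw [ENNReal.mul_rpow_of_nonneg _ _ hs.le, ← ENNReal.rpow_natCast_mul, mul_comm (k : ℝ),
          ENNReal.rpow_mul_natCast, mul_comm]
  refine (lqNorm_mono mesh_rpow_le).trans_lt ?_
  rw [lqNorm_const_mul hq]
  exact ENNReal.mul_lt_top (ENNReal.rpow_lt_top_of_nonneg hs.le (measure_ne_top _ _))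
    (lqNorm_geometric_lt_top hq (hG.ofReal_l₂_rpow_lt_one hs))

lemma holderConst_mesh_lt_top {s p : ℝ} (hs : 0 < s) (hp : 0 < p) {q : ℝ≥0∞} (hq : 1 ≤ q) :
    holderConst p q (fun k => G.mesh k ^ (s * p)) < ∞ := by
  have hq' : q.conjExponent ≠ 0 := by simp [ENNReal.conjExponent]
  simpa only [holderConst_eq_lqNorm p hq, ← ENNReal.rpow_mul, mul_assoc,
    mul_one_div_cancel hp.ne', mul_one] using hG.lqNorm_mesh_rpow_lt_top hq' hs

theorem oscConst_lt_top {s p : ℝ} (hs : 0 < s) (hp : 0 < p) {q : ℝ≥0∞} (hq : 1 ≤ q) :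
    G.oscConst l₂ s p q < ∞ := by
  rw [oscConst, hG.overlap_eq_one, ENNReal.one_rpow, one_mul]
  exact ENNReal.add_lt_top.2 ⟨ENNReal.mul_lt_top (hG.holderConst_mesh_lt_top hs hp hq)
    (ENNReal.rpow_ne_top_of_ne_zero hG.measure_univ_pos.ne' (measure_ne_top _ _)).lt_top,
    ENNReal.ofReal_lt_top⟩

end IsGood

end Grid

lemma Grid.Choices.isEnumeration (D : G.Choices) : IsEnumeration D.order :=
  ⟨D.nodup_order, D.mem_order⟩

/-! ### Absolutely convergent series in `L^p` -/

section LpSeries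

variable {E : Type*} [NormedAddCommGroup E] {f : I → E} {g : ℕ → I → E} {p : ℝ≥0∞}

lemma eLpNorm_sum_range_le_tsum (hp : 1 ≤ p) (hg : ∀ k, AEStronglyMeasurable (g k) m) (n N : ℕ) :
    eLpNorm (∑ i ∈ Finset.range N, g (n + i)) p m ≤ ∑' i, eLpNorm (g (n + i)) p m :=
  (eLpNorm_sum_le (fun i _ => hg (n + i)) hp).trans (ENNReal.sum_le_tsum _)

lemma eLpNorm_sub_sum_le_tsum_of_tendsto (hp : 1 ≤ p) (hf : AEStronglyMeasurable f m)
    (hg : ∀ k, AEStronglyMeasurable (g k) m)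
    (h : Tendsto (fun n => eLpNorm (fun x => f x - ∑ k ∈ Finset.range n, g k x) p m) atTop (𝓝 0))
    (n : ℕ) :
    eLpNorm (fun x => f x - ∑ k ∈ Finset.range n, g k x) p m ≤ ∑' i, eLpNorm (g (n + i)) p m := by
  have remainder_le (N : ℕ) : eLpNorm (fun x => f x - ∑ k ∈ Finset.range n, g k x) p m ≤
      eLpNorm (fun x => f x - ∑ k ∈ Finset.range (N + n), g k x) p m +
        ∑' i, eLpNorm (g (n + i)) p m := by
    have split : (fun x => f x - ∑ k ∈ Finset.range n, g k x) =
        (fun x => f x - ∑ k ∈ Finset.range (N + n), g k x) +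
          ∑ i ∈ Finset.range N, g (n + i) := by
      ext x
      rw [Pi.add_apply, Finset.sum_apply, add_comm N, Finset.sum_range_add]
      abel
    rw [split]
    refine (eLpNorm_add_le (hf.sub ?_) (Finset.aestronglyMeasurable_sum _ fun i _ => hg _) hp).trans
      (add_le_add_right (eLpNorm_sum_range_le_tsum hp hg n N) _)
    exact Finset.aestronglyMeasurable_fun_sum _ fun k _ => hg k
  have hlim := (h.comp (tendsto_add_atTop_nat n)).add_const (∑' i, eLpNorm (g (n + i)) p m)
  rw [zero_add] at hlim
  exact ge_of_tendsto' hlim remainder_le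

lemma eLpNorm_sub_sum_le_tsum_of_ae_tendsto (hp : 1 ≤ p) (hg : ∀ k, AEStronglyMeasurable (g k) m)
    (h : ∀ᵐ x ∂m, Tendsto (fun n => ∑ k ∈ Finset.range n, g k x) atTop (𝓝 (f x))) (n : ℕ) :
    eLpNorm (fun x => f x - ∑ k ∈ Finset.range n, g k x) p m ≤ ∑' i, eLpNorm (g (n + i)) p m := by
  have hlim : ∀ᵐ x ∂m, Tendsto (fun N => (∑ i ∈ Finset.range N, g (n + i)) x) atTop
      (𝓝 (f x - ∑ k ∈ Finset.range n, g k x)) := by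
    filter_upwards [h] with x hx
    refine ((hx.comp (tendsto_add_atTop_nat n)).sub_const _).congr fun N => ?_
    simp [add_comm N, Finset.sum_range_add]
  refine (Lp.eLpNorm_lim_le_liminf_eLpNorm
    (fun N => Finset.aestronglyMeasurable_sum _ fun i _ => hg _) _ hlim).trans
    (liminf_le_of_le (by isBoundedDefault) fun b hb => ?_)
  obtain ⟨N, hN⟩ := hb.exists
  exact hN.trans (eLpNorm_sum_range_le_tsum hp hg n N)

end LpSeries

/-! ### Averages over the cells -/

namespace Grid

section StepFun

variable {E : Type*}

/-- The step function with the value `v Q` on every cell `Q` of level `k`, and `0` off the cells. -/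
def stepFun [AddCommMonoid E] (G : Grid m) (k : ℕ) (v : Set I → E) (x : I) : E :=
  ∑ Q ∈ G.cells k, Q.indicator (fun _ => v Q) x

variable [NormedAddCommGroup E]

lemma integrable_stepFun [IsFiniteMeasure m] (k : ℕ) (v : Set I → E) :
    Integrable (G.stepFun k v) m :=
  integrable_finsetSum _ fun Q hQ =>
    (integrable_const (v Q)).indicator (G.measurableSet_of_mem k Q hQ)

/-- The function that is equal on every cell of level `n` to the average of `f` over that cell. -/
def average [NormedSpace ℝ E] (G : Grid m) (f : I → E) (n : ℕ) : I → E :=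
  G.stepFun n fun Q => ⨍ y in Q, f y ∂m

/-- The filtration generated by the cells. -/
def filtration (G : Grid m) : Filtration ℕ ‹MeasurableSpace I› where
  seq n := MeasurableSpace.generateFrom (⋃ k ≤ n, (G.cells k : Set (Set I)))
  mono' _ _ h := MeasurableSpace.generateFrom_mono
    (Set.biUnion_subset_biUnion_left fun _ hk => le_trans hk h)
  le' n := MeasurableSpace.generateFrom_le fun Q hQ => by
    obtain ⟨k, -, hQ⟩ := Set.mem_iUnion₂.1 hQ
    exact G.measurableSet_of_mem k Q hQ

lemma measurableSet_filtration {n : ℕ} {Q : Set I} (hQ : Q ∈ G.cells n) :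
    MeasurableSet[G.filtration n] Q :=
  MeasurableSpace.measurableSet_generateFrom (Set.mem_iUnion₂.2 ⟨n, le_rfl, hQ⟩)

lemma stronglyMeasurable_stepFun (k : ℕ) (v : Set I → E) :
    StronglyMeasurable[G.filtration k] (G.stepFun k v) :=
  Finset.stronglyMeasurable_fun_sum _ fun _ hQ =>
    stronglyMeasurable_const.indicator (measurableSet_filtration hQ)

lemma aestronglyMeasurable_stepFun (k : ℕ) (v : Set I → E) :
    AEStronglyMeasurable (G.stepFun k v) m :=
  ((stronglyMeasurable_stepFun k v).mono (G.filtration.le k)).aestronglyMeasurable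

end StepFun

namespace IsGood

variable (hG : G.IsGood l₁ l₂)

include hG

lemma stepFun_eq {E : Type*} [AddCommMonoid E] {k : ℕ} {Q : Set I} (hQ : Q ∈ G.cells k) {x : I}
    (hx : x ∈ Q) (v : Set I → E) : G.stepFun k v x = v Q := by
  rw [stepFun, Finset.sum_eq_single_of_mem Q hQ, Set.indicator_of_mem hx]
  exact fun R hR hne => Set.indicator_of_notMem (fun h => hne (hG.eq_of_mem hR hQ h hx)) _

lemma ae_exists_mem (n : ℕ) : ∀ᵐ x ∂m, ∃ Q ∈ G.cells n, x ∈ Q := by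
  filter_upwards [measure_eq_zero_iff_ae_notMem.1 (hG.cover n)] with x hx
  simpa using hx

lemma subset_or_disjoint {n : ℕ} {t : Set I} (ht : MeasurableSet[G.filtration n] t) {Q : Set I}
    (hQ : Q ∈ G.cells n) : Q ⊆ t ∨ Disjoint Q t := by
  induction t, ht using MeasurableSpace.generateFrom_induction with
  | hC P hP =>
    obtain ⟨k, hkn, hP⟩ := Set.mem_iUnion₂.1 hP
    refine or_iff_not_imp_right.2 fun h => ?_
    obtain ⟨x, hxQ, hxP⟩ := Set.not_disjoint_iff.1 h
    exact hG.subset_of_mem hkn hP hQ hxP hxQ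
  | empty => exact .inr (Set.disjoint_empty Q)
  | compl t _ h =>
    exact h.symm.imp Set.subset_compl_iff_disjoint_right.2 Set.disjoint_compl_right_iff_subset.2
  | iUnion t _ h =>
    by_cases hsub : ∃ i, Q ⊆ t i
    · exact .inl (hsub.elim fun i hi => hi.trans (Set.subset_iUnion t i))
    · exact .inr (Set.disjoint_iUnion_right.2 fun i => (h i).resolve_left (not_exists.1 hsub i))

lemma iSup_filtration : ⨆ n, G.filtration n = ‹MeasurableSpace I› := by
  refine le_antisymm (iSup_le G.filtration.le) ?_
  nth_rw 1 [hG.generate]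
  refine MeasurableSpace.generateFrom_le fun Q hQ => ?_
  obtain ⟨k, hQ⟩ := Set.mem_iUnion.1 hQ
  exact le_iSup (fun n => G.filtration n) k Q (measurableSet_filtration hQ)

lemma average_eq {E : Type*} [NormedAddCommGroup E] [NormedSpace ℝ E] {n : ℕ} {Q : Set I}
    (hQ : Q ∈ G.cells n) {x : I} (hx : x ∈ Q) (f : I → E) :
    G.average f n x = ⨍ y in Q, f y ∂m := hG.stepFun_eq hQ hx _

lemma setIntegral_eq_of_measurableSet_filtration {E : Type*} [NormedAddCommGroup E]
    [NormedSpace ℝ E] {n : ℕ} {f g : I → E} (hf : Integrable f m) (hg : Integrable g m)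
    (h : ∀ Q ∈ G.cells n, ∫ x in Q, f x ∂m = ∫ x in Q, g x ∂m) {t : Set I}
    (ht : MeasurableSet[G.filtration n] t) : ∫ x in t, f x ∂m = ∫ x in t, g x ∂m := by
  have ht' := G.filtration.le n t ht
  have sum_inter {f : I → E} (hf : Integrable f m) :
      ∫ x in t, f x ∂m = ∑ Q ∈ G.cells n, ∫ x in Q ∩ t, f x ∂m := by
    rw [← integral_indicator ht', ← setIntegral_univ,
      hG.setIntegral_eq_sum (Nat.zero_le n) hG.univ_mem (hf.indicator ht'), descendants_univ]
    exact Finset.sum_congr rfl fun Q _ => setIntegral_indicator ht'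
  rw [sum_inter hf, sum_inter hg]
  refine Finset.sum_congr rfl fun Q hQ => ?_
  rcases hG.subset_or_disjoint ht hQ with hQt | hQt
  · rw [Set.inter_eq_left.2 hQt, h Q hQ]
  · simp [hQt.inter_eq]

variable [IsFiniteMeasure m]

lemma setIntegral_average {E : Type*} [NormedAddCommGroup E] [NormedSpace ℝ E] [CompleteSpace E]
    {n : ℕ} {Q : Set I} (hQ : Q ∈ G.cells n) (f : I → E) :
    ∫ x in Q, G.average f n x ∂m = ∫ x in Q, f x ∂m := by
  rw [setIntegral_congr_fun (G.measurableSet_of_mem n Q hQ) fun x hx => hG.average_eq hQ hx f,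
    setIntegral_const, measure_smul_setAverage f (measure_ne_top m Q)]

lemma average_ae_eq_condExp {E : Type*} [NormedAddCommGroup E] [NormedSpace ℝ E] [CompleteSpace E]
    {f : I → E} (hf : Integrable f m) (n : ℕ) : G.average f n =ᵐ[m] m[f | G.filtration n] :=
  ae_eq_condExp_of_forall_setIntegral_eq (G.filtration.le n) hf
    (fun _ _ _ => (integrable_stepFun n _).integrableOn)
    (fun _ ht _ => hG.setIntegral_eq_of_measurableSet_filtration (integrable_stepFun n _) hf
      (fun _ hQ => hG.setIntegral_average hQ f) ht)
    (stronglyMeasurable_stepFun n _).aestronglyMeasurable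

theorem ae_tendsto_average {f : I → ℂ} (hf : Integrable f m) :
    ∀ᵐ x ∂m, Tendsto (fun n => G.average f n x) atTop (𝓝 (f x)) := by
  have tendsto_comp (L : ℂ →L[ℝ] ℝ) :
      ∀ᵐ x ∂m, Tendsto (fun n => L (G.average f n x)) atTop (𝓝 (L (f x))) := by
    have hLf : Integrable (L ∘ f) m := L.integrable_comp hf
    have hlim : m[L ∘ f | ⨆ n, G.filtration n] =ᵐ[m] L ∘ f :=
      condExp_of_aestronglyMeasurable' (iSup_le G.filtration.le)
        (by rw [hG.iSup_filtration]; exact hLf.1) hLf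
    have hcomm : ∀ n, ∀ᵐ x ∂m, L (G.average f n x) = (m[L ∘ f | G.filtration n]) x := fun n => by
      filter_upwards [hG.average_ae_eq_condExp hf n, L.comp_condExp_comm hf] with x h₁ h₂
      rw [h₁, ← h₂, Function.comp_apply]
    filter_upwards [hlim, ae_all_iff.2 hcomm, tendsto_ae_condExp (ℱ := G.filtration) (L ∘ f)]
      with x h₁ h₂ h₃
    simpa only [h₁, h₂, Function.comp_apply] using h₃
  filter_upwards [tendsto_comp Complex.reCLM, tendsto_comp Complex.imCLM] with x hre him
  exact (Complex.equivRealProdCLM.symm.continuous.tendsto _).comp (hre.prodMk_nhds him)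

end IsGood

end Grid

/-! ### Atomic representations -/

lemma eLpNorm_ofReal {E : Type*} [NormedAddCommGroup E] {p : ℝ} (hp : 0 < p) (f : I → E)
    (μ : Measure I) :
    eLpNorm f (ENNReal.ofReal p) μ = (∫⁻ x, ‖f x‖ₑ ^ p ∂μ) ^ (1 / p) := by
  rw [eLpNorm_eq_lintegral_rpow_enorm_toReal (by simpa using hp) ENNReal.ofReal_ne_top,
    ENNReal.toReal_ofReal hp.le]

lemma enorm_measureReal_rpow [IsFiniteMeasure m] {Q : Set I} (hQ : m Q ≠ 0) (r : ℝ) :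
    ‖((m.real Q ^ r : ℝ) : ℂ)‖ₑ = m Q ^ r := by
  have hpos : 0 < m.real Q := ENNReal.toReal_pos hQ (measure_ne_top _ _)
  rw [← ofReal_norm, Complex.norm_real, Real.norm_of_nonneg (by positivity),
    ← ENNReal.ofReal_rpow_of_pos hpos, ofReal_measureReal (measure_ne_top _ _)]

/-- The canonical Souza's atom on `Q`, which has the largest value that the definition allows. -/
def canonicalAtom (m : Measure I) (s p : ℝ) (Q : Set I) : I → ℂ :=
  Q.indicator fun _ => ((m.real Q ^ (s - 1 / p) : ℝ) : ℂ)

section Atoms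

variable [IsFiniteMeasure m] {s p : ℝ} {Q : Set I}

lemma isSouzaAtom_canonicalAtom (hQ : m Q ≠ 0) : IsSouzaAtom m s p Q (canonicalAtom m s p Q) where
  eq_zero x hx := Set.indicator_of_notMem hx _
  const := ⟨_, fun x hx => Set.indicator_of_mem hx _⟩
  norm_le := by
    rw [eLpNorm_exponent_top, canonicalAtom, ← enorm_measureReal_rpow hQ]
    exact eLpNormEssSup_indicator_const_le _ _

lemma IsSouzaAtom.exists_eq_mul_canonicalAtom {a : I → ℂ} (ha : IsSouzaAtom m s p Q a)
    (hQ : m Q ≠ 0) : ∃ z : ℂ, ‖z‖ₑ ≤ 1 ∧ ∀ x, a x = z * canonicalAtom m s p Q x := by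
  obtain ⟨v, hv⟩ := ha.const
  have eq_indicator : a = Q.indicator fun _ => v := by
    ext x
    by_cases hx : x ∈ Q
    · rw [Set.indicator_of_mem hx, hv x hx]
    · rw [Set.indicator_of_notMem hx, ha.eq_zero x hx]
  have hv_le : ‖v‖ₑ ≤ m Q ^ (s - 1 / p) := by
    simpa [eq_indicator, eLpNorm_exponent_top, eLpNormEssSup_indicator_const_eq Q v hQ]
      using ha.norm_le
  have hpos : 0 < m.real Q := ENNReal.toReal_pos hQ (measure_ne_top _ _)
  have hr : ((m.real Q ^ (s - 1 / p) : ℝ) : ℂ) ≠ 0 := by exact_mod_cast (by positivity)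
  refine ⟨v * ((m.real Q ^ (s - 1 / p) : ℝ) : ℂ)⁻¹, ?_, fun x => ?_⟩
  · rw [enorm_mul, enorm_inv hr, enorm_measureReal_rpow hQ, ← div_eq_mul_inv]
    exact ENNReal.div_le_of_le_mul (by rwa [one_mul])
  · rw [eq_indicator, canonicalAtom]
    by_cases hx : x ∈ Q
    · rw [Set.indicator_of_mem hx, Set.indicator_of_mem hx, inv_mul_cancel_right₀ hr]
    · rw [Set.indicator_of_notMem hx, Set.indicator_of_notMem hx, mul_zero]

/-- A representation by arbitrary atoms becomes one by canonical atoms when the quotients of the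
atoms are moved into the coefficients, which does not increase their absolute values. -/
lemma Grid.IsRepresentation.exists_canonical {c : Set I → ℂ} {a : Set I → I → ℂ} {f : I → ℂ}
    (h : G.IsRepresentation s p c a f) :
    ∃ c' : Set I → ℂ, (∀ k, ∀ Q ∈ G.cells k, ‖c' Q‖ₑ ≤ ‖c Q‖ₑ) ∧
      G.IsRepresentation s p c' (canonicalAtom m s p) f := by
  have hne (k : ℕ) (Q : Set I) (hQ : Q ∈ G.cells k) : m Q ≠ 0 := (G.measure_pos k Q hQ).ne'
  have exists_quotient (Q : Set I) (hQ : ∃ k, Q ∈ G.cells k) :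
      ∃ z : ℂ, ‖z‖ₑ ≤ 1 ∧ ∀ x, a Q x = z * canonicalAtom m s p Q x :=
    hQ.elim fun k hQ => (h.atom k Q hQ).exists_eq_mul_canonicalAtom (hne k Q hQ)
  choose! z hz using exists_quotient
  have block_eq (k : ℕ) :
      G.block (fun Q => c Q * z Q) (canonicalAtom m s p) k = G.block c a k := by
    ext x
    refine Finset.sum_congr rfl fun Q hQ => ?_
    rw [(hz Q ⟨k, hQ⟩).2, mul_assoc]
  refine ⟨fun Q => c Q * z Q, fun k Q hQ => ?_,
    fun k Q hQ => isSouzaAtom_canonicalAtom (hne k Q hQ), ?_, ?_⟩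
  · rw [enorm_mul]
    exact mul_le_of_le_one_right' (hz Q ⟨k, hQ⟩).1
  · simpa only [block_eq] using h.abs_conv
  · simpa only [block_eq] using h.tendsto

end Atoms

lemma Grid.cost_mono {p : ℝ} (hp : 0 ≤ p) {q : ℝ≥0∞} {c c' : Set I → ℂ}
    (h : ∀ k, ∀ Q ∈ G.cells k, ‖c' Q‖ₑ ≤ ‖c Q‖ₑ) : G.cost p q c' ≤ G.cost p q c :=
  lqNorm_mono fun k => lpSum_mono _ hp (h k)

/-- The `k`-th block of the series of multiples of canonical atoms, written as a step function. -/
def Grid.canonicalBlock (G : Grid m) (s p : ℝ) (c : Set I → ℂ) (k : ℕ) : I → ℂ :=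
  G.stepFun k fun Q => c Q * ((m.real Q ^ (s - 1 / p) : ℝ) : ℂ)

lemma Grid.block_canonicalAtom (s p : ℝ) (c : Set I → ℂ) (k : ℕ) :
    G.block c (canonicalAtom m s p) k = G.canonicalBlock s p c k := by
  ext x
  refine Finset.sum_congr rfl fun Q _ => ?_
  by_cases hx : x ∈ Q <;> simp [canonicalAtom, hx]

/-- The weighted measure `∑_{Q ∈ P^k} |Q|^{-sp} m|_Q`, whose `L^p` norm of `f - g` bounds the
level `k` term of the oscillation norm of `f` when `g` is constant on the cells of level `k`. -/
def Grid.levelMeasure (G : Grid m) (s p : ℝ) (k : ℕ) : Measure I :=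
  ∑ Q ∈ G.cells k, m Q ^ (-(s * p)) • m.restrict Q

lemma Grid.lintegral_levelMeasure (s p : ℝ) (k : ℕ) (f : I → ℝ≥0∞) :
    ∫⁻ x, f x ∂(G.levelMeasure s p k) =
      ∑ Q ∈ G.cells k, m Q ^ (-(s * p)) * ∫⁻ x in Q, f x ∂m := by
  simp only [levelMeasure, lintegral_finsetSum_measure, lintegral_smul_measure, smul_eq_mul]

lemma Grid.levelMeasure_le (s p : ℝ) (k : ℕ) :
    G.levelMeasure s p k ≤ (∑ Q ∈ G.cells k, m Q ^ (-(s * p))) • m := by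
  rw [levelMeasure, Finset.sum_smul]
  gcongr
  exact Measure.restrict_le_self

lemma tendsto_eLpNorm_of_measure_le_smul {E : Type*} [NormedAddCommGroup E] {p : ℝ≥0∞}
    (hp : p ≠ ∞) {ν : Measure I} {C : ℝ≥0∞} (hC : C ≠ ∞) (hν : ν ≤ C • m) {F : ℕ → I → E}
    (h : Tendsto (fun n => eLpNorm (F n) p m) atTop (𝓝 0)) :
    Tendsto (fun n => eLpNorm (F n) p ν) atTop (𝓝 0) := by
  have hlim := ENNReal.Tendsto.const_mul (a := C ^ (1 / p).toReal) h
    (.inr (ENNReal.rpow_ne_top_of_nonneg ENNReal.toReal_nonneg hC))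
  rw [mul_zero] at hlim
  refine tendsto_of_tendsto_of_tendsto_of_le_of_le tendsto_const_nhds hlim (fun _ => zero_le)
    fun n => (eLpNorm_mono_measure _ hν).trans_eq ?_
  rw [eLpNorm_smul_measure_of_ne_top hp, smul_eq_mul]

lemma Grid.IsRepresentation.eLpNorm_sub_sum_le {s p : ℝ} (hp : 1 ≤ p) {c : Set I → ℂ}
    {f : I → ℂ} (h : G.IsRepresentation s p c (canonicalAtom m s p) f)
    (hf : AEStronglyMeasurable f m) {ν : Measure I} {C : ℝ≥0∞} (hC : C ≠ ∞) (hν : ν ≤ C • m)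
    (n : ℕ) :
    eLpNorm (fun x => f x - ∑ k ∈ Finset.range n, G.canonicalBlock s p c k x)
      (ENNReal.ofReal p) ν ≤
      ∑' i, eLpNorm (G.canonicalBlock s p c (n + i)) (ENNReal.ofReal p) ν := by
  have hac : ν ≪ m := Measure.absolutelyContinuous_of_le_smul hν
  have hlim := h.tendsto
  simp only [block_canonicalAtom] at hlim
  exact eLpNorm_sub_sum_le_tsum_of_tendsto (by simpa using hp) (hf.mono_ac hac)
    (fun k => (aestronglyMeasurable_stepFun k _).mono_ac hac)
    (tendsto_eLpNorm_of_measure_le_smul ENNReal.ofReal_ne_top hC hν hlim) n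

lemma osc_rpow_le {p : ℝ} (hp : 0 < p) {f g : I → ℂ} {Q : Set I} (hQ : MeasurableSet Q) {z : ℂ}
    (hg : ∀ x ∈ Q, g x = z) : osc m p f Q ^ p ≤ ∫⁻ x in Q, ‖f x - g x‖ₑ ^ p ∂m := by
  rw [← ENNReal.le_rpow_inv_iff hp, ← one_div]
  refine (iInf_le _ z).trans_eq (congrArg (· ^ (1 / p)) ?_)
  exact setLIntegral_congr_fun hQ fun x hx => by rw [hg x hx]

lemma Grid.oscNorm_eq {p : ℝ} (hp : 0 < p) (s : ℝ) (q : ℝ≥0∞) (f : I → ℂ) :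
    G.oscNorm s p q f = m Set.univ ^ (-s) * eLpNorm f (ENNReal.ofReal p) m +
      lqNorm q fun k => lpSum p (G.cells k) fun Q => m Q ^ (-s) * osc m p f Q := by
  simp only [oscNorm, lpSum, ENNReal.mul_rpow_of_nonneg _ _ hp.le, ← ENNReal.rpow_mul, neg_mul]

namespace Grid.IsGood

variable (hG : G.IsGood l₁ l₂)
include hG

lemma setLIntegral_enorm_stepFun_rpow {E : Type*} [NormedAddCommGroup E] (p : ℝ) {j k : ℕ}
    (hjk : j ≤ k) {Q : Set I} (hQ : Q ∈ G.cells j) (v : Set I → E) :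
    ∫⁻ x in Q, ‖G.stepFun k v x‖ₑ ^ p ∂m = ∑ P ∈ G.descendants k Q, ‖v P‖ₑ ^ p * m P := by
  rw [hG.setLIntegral_eq_sum hjk hQ]
  refine Finset.sum_congr rfl fun P hP => ?_
  rw [← setLIntegral_const]
  exact setLIntegral_congr_fun (measurableSet_of_mem_descendants P hP) fun x hx => by
    rw [hG.stepFun_eq (mem_descendants.1 hP).1 hx]

lemma sum_sum_descendants {M : Type*} [AddCommMonoid M] {j k : ℕ} (hjk : j ≤ k) (F : Set I → M) :
    ∑ Q ∈ G.cells j, ∑ P ∈ G.descendants k Q, F P = ∑ P ∈ G.cells k, F P := by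
  classical
  simp only [descendants, Finset.sum_filter]
  rw [Finset.sum_comm]
  refine Finset.sum_congr rfl fun P hP => ?_
  obtain ⟨i, rfl⟩ := Nat.exists_eq_add_of_le hjk
  obtain ⟨Q, hQ, hPQ⟩ := hG.exists_ancestor j i hP
  obtain ⟨x, hx⟩ := nonempty_of_mem_cells hP
  rw [Finset.sum_eq_single_of_mem Q hQ, if_pos hPQ]
  exact fun R hR hne => if_neg fun h => hne (hG.eq_of_mem hR hQ (h hx) (hPQ hx))

lemma sum_canonicalBlock_eq_of_mem (s p : ℝ) (c : Set I → ℂ) {k : ℕ} {Q : Set I}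
    (hQ : Q ∈ G.cells k) {x y : I} (hx : x ∈ Q) (hy : y ∈ Q) :
    ∑ j ∈ Finset.range (k + 1), G.canonicalBlock s p c j x =
      ∑ j ∈ Finset.range (k + 1), G.canonicalBlock s p c j y := by
  refine Finset.sum_congr rfl fun j hj => ?_
  obtain ⟨i, rfl⟩ := Nat.exists_eq_add_of_le (Nat.lt_succ_iff.1 (Finset.mem_range.1 hj))
  obtain ⟨R, hR, hQR⟩ := hG.exists_ancestor j i hQ
  rw [canonicalBlock, hG.stepFun_eq hR (hQR hx), hG.stepFun_eq hR (hQR hy)]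

lemma ofReal_one_div_one_sub_rpow {s : ℝ} (hs : 0 < s) :
    ENNReal.ofReal (1 / (1 - l₂ ^ s)) = (1 - ENNReal.ofReal l₂ ^ s)⁻¹ := by
  have h1 : l₂ ^ s < 1 := Real.rpow_lt_one hG.l₂_pos.le hG.lt_one hs
  rw [one_div, ENNReal.ofReal_inv_of_pos (sub_pos.2 h1), ENNReal.ofReal_sub _
    (Real.rpow_nonneg hG.l₂_pos.le s), ENNReal.ofReal_one, ENNReal.ofReal_rpow_of_pos hG.l₂_pos]

variable [IsFiniteMeasure m] {s p : ℝ} {q : ℝ≥0∞} {c : Set I → ℂ} {f : I → ℂ}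

lemma setLIntegral_enorm_canonicalBlock_rpow (s : ℝ) (hp : 0 < p) (c : Set I → ℂ) {j k : ℕ}
    (hjk : j ≤ k) {Q : Set I} (hQ : Q ∈ G.cells j) :
    ∫⁻ x in Q, ‖G.canonicalBlock s p c k x‖ₑ ^ p ∂m =
      ∑ P ∈ G.descendants k Q, m P ^ (s * p) * ‖c P‖ₑ ^ p := by
  rw [canonicalBlock, hG.setLIntegral_enorm_stepFun_rpow p hjk hQ]
  refine Finset.sum_congr rfl fun P hP => ?_
  have hP0 : m P ≠ 0 := (G.measure_pos k P (mem_descendants.1 hP).1).ne'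
  rw [enorm_mul, enorm_measureReal_rpow hP0, ENNReal.mul_rpow_of_nonneg _ _ hp.le,
    ← ENNReal.rpow_mul, mul_assoc, mul_comm]
  nth_rw 2 [← ENNReal.rpow_one (m P)]
  rw [← ENNReal.rpow_add _ _ hP0 (measure_ne_top _ _), sub_mul, one_div_mul_cancel hp.ne',
    sub_add_cancel]

lemma eLpNorm_canonicalBlock_le (hs : 0 ≤ s) (hp : 0 < p) (c : Set I → ℂ) (k : ℕ) :
    eLpNorm (G.canonicalBlock s p c k) (ENNReal.ofReal p) m ≤
      G.mesh k ^ s * lpSum p (G.cells k) fun Q => ‖c Q‖ₑ := by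
  rw [eLpNorm_ofReal hp, ← setLIntegral_univ,
    hG.setLIntegral_enorm_canonicalBlock_rpow s hp c (Nat.zero_le k) hG.univ_mem,
    descendants_univ, ← lpSum_const_mul _ hp, lpSum]
  gcongr with Q hQ
  rw [ENNReal.mul_rpow_of_nonneg _ _ hp.le, ← ENNReal.rpow_mul]
  gcongr
  exact le_iSup₂_of_le Q hQ le_rfl

lemma tsum_eLpNorm_canonicalBlock_le (hs : 0 ≤ s) (hp : 0 < p) (hq : 1 ≤ q) (c : Set I → ℂ) :
    ∑' k, eLpNorm (G.canonicalBlock s p c k) (ENNReal.ofReal p) m ≤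
      holderConst p q (fun k => G.mesh k ^ (s * p)) * G.cost p q c := by
  have : q.HolderConjugate q.conjExponent := ENNReal.HolderConjugate.conjExponent hq
  rw [holderConst_eq_lqNorm p hq]
  refine (ENNReal.tsum_le_tsum fun k => ?_).trans (tsum_mul_le_lqNorm_mul_lqNorm this.symm _ _)
  rw [← ENNReal.rpow_mul, mul_assoc, mul_one_div_cancel hp.ne', mul_one]
  exact hG.eLpNorm_canonicalBlock_le hs hp c k

lemma eLpNorm_canonicalBlock_levelMeasure_le (hs : 0 ≤ s) (hp : 0 < p) (c : Set I → ℂ) (k i : ℕ) :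
    eLpNorm (G.canonicalBlock s p c (k + i)) (ENNReal.ofReal p) (G.levelMeasure s p k) ≤
      (ENNReal.ofReal l₂ ^ s) ^ i * lpSum p (G.cells (k + i)) fun Q => ‖c Q‖ₑ := by
  have ratio_le {Q P : Set I} (hQ : Q ∈ G.cells k) (hP : P ∈ G.descendants (k + i) Q) :
      m Q ^ (-(s * p)) * m P ^ (s * p) ≤ ((ENNReal.ofReal l₂ ^ s) ^ i) ^ p := by
    obtain ⟨hP, hPQ⟩ := mem_descendants.1 hP
    have hdiv : m P / m Q ≤ ENNReal.ofReal l₂ ^ i :=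
      ENNReal.div_le_of_le_mul (hG.measure_le_pow_mul k i hQ hP hPQ)
    calc m Q ^ (-(s * p)) * m P ^ (s * p) = (m P / m Q) ^ (s * p) := by
          rw [ENNReal.rpow_neg, mul_comm, ← div_eq_mul_inv,
            ENNReal.div_rpow_of_nonneg _ _ (by positivity)]
      _ ≤ (ENNReal.ofReal l₂ ^ i) ^ (s * p) := by gcongr
      _ = ((ENNReal.ofReal l₂ ^ s) ^ i) ^ p := by
          rw [ENNReal.rpow_mul, ← ENNReal.rpow_natCast_mul, ← ENNReal.rpow_mul_natCast, mul_comm s]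
  rw [eLpNorm_ofReal hp, lintegral_levelMeasure, ← lpSum_const_mul _ hp, lpSum,
    ← hG.sum_sum_descendants (Nat.le_add_right k i)]
  gcongr with Q hQ
  rw [hG.setLIntegral_enorm_canonicalBlock_rpow s hp c (Nat.le_add_right k i) hQ, Finset.mul_sum]
  refine Finset.sum_le_sum fun P hP => ?_
  rw [ENNReal.mul_rpow_of_nonneg _ _ hp.le, ← mul_assoc]
  gcongr
  exact ratio_le hQ hP

lemma lpSum_osc_le (hs : 0 ≤ s) (hp : 1 ≤ p) (hf : AEStronglyMeasurable f m)
    (h : G.IsRepresentation s p c (canonicalAtom m s p) f) (k : ℕ) :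
    lpSum p (G.cells k) (fun Q => m Q ^ (-s) * osc m p f Q) ≤
      ∑' i, (ENNReal.ofReal l₂ ^ s) ^ (i + 1) *
        lpSum p (G.cells (k + (i + 1))) fun Q => ‖c Q‖ₑ := by
  have hp0 : 0 < p := one_pos.trans_le hp
  have hweight : ∑ Q ∈ G.cells k, m Q ^ (-(s * p)) ≠ ∞ := ENNReal.sum_ne_top.2 fun Q hQ =>
    ENNReal.rpow_ne_top_of_ne_zero (G.measure_pos k Q hQ).ne' (measure_ne_top _ _)
  calc lpSum p (G.cells k) (fun Q => m Q ^ (-s) * osc m p f Q)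
      ≤ eLpNorm (fun x => f x - ∑ j ∈ Finset.range (k + 1), G.canonicalBlock s p c j x)
          (ENNReal.ofReal p) (G.levelMeasure s p k) := by
        simp only [eLpNorm_ofReal hp0, lintegral_levelMeasure, lpSum,
          ENNReal.mul_rpow_of_nonneg _ _ hp0.le, ← ENNReal.rpow_mul, neg_mul]
        gcongr with Q hQ
        obtain ⟨y, hy⟩ := nonempty_of_mem_cells hQ
        exact osc_rpow_le hp0 (G.measurableSet_of_mem k Q hQ)
          fun x hx => hG.sum_canonicalBlock_eq_of_mem s p c hQ hx hy
    _ ≤ ∑' i, eLpNorm (G.canonicalBlock s p c (k + 1 + i)) (ENNReal.ofReal p)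
          (G.levelMeasure s p k) :=
        h.eLpNorm_sub_sum_le hp hf hweight (levelMeasure_le s p k) (k + 1)
    _ ≤ _ := ENNReal.tsum_le_tsum fun i => by
        rw [add_assoc, add_comm 1 i]
        exact hG.eLpNorm_canonicalBlock_levelMeasure_le hs hp0 c k (i + 1)

lemma eLpNorm_le_cost (hs : 0 ≤ s) (hp : 1 ≤ p) (hq : 1 ≤ q) (hf : AEStronglyMeasurable f m)
    (h : G.IsRepresentation s p c (canonicalAtom m s p) f) :
    eLpNorm f (ENNReal.ofReal p) m ≤
      holderConst p q (fun k => G.mesh k ^ (s * p)) * G.cost p q c := by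
  refine le_trans ?_ (hG.tsum_eLpNorm_canonicalBlock_le hs (one_pos.trans_le hp) hq c)
  simpa using h.eLpNorm_sub_sum_le hp hf ENNReal.one_ne_top (one_smul _ m).ge 0

lemma oscNorm_le_cost (hs : 0 < s) (hp : 1 ≤ p) (hq : 1 ≤ q) (hf : AEStronglyMeasurable f m)
    (h : G.IsRepresentation s p c (canonicalAtom m s p) f) :
    G.oscNorm s p q f ≤ G.oscConst l₂ s p q * G.cost p q c := by
  rw [oscNorm_eq (one_pos.trans_le hp), oscConst, hG.overlap_eq_one, ENNReal.one_rpow, one_mul,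
    add_mul, mul_comm (holderConst p q _), mul_assoc]
  gcongr
  · exact hG.eLpNorm_le_cost hs.le hp hq hf h
  · calc lqNorm q (fun k => lpSum p (G.cells k) fun Q => m Q ^ (-s) * osc m p f Q)
        ≤ lqNorm q fun k => ∑' i, (ENNReal.ofReal l₂ ^ s) ^ (i + 1) *
            lpSum p (G.cells (k + (i + 1))) fun Q => ‖c Q‖ₑ :=
          lqNorm_mono fun k => hG.lpSum_osc_le hs.le hp hf h k
      _ ≤ lqNorm q fun k => ∑' i, (ENNReal.ofReal l₂ ^ s) ^ i *
            lpSum p (G.cells (k + i)) fun Q => ‖c Q‖ₑ :=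
          lqNorm_mono fun k => ENNReal.tsum_comp_le_tsum_of_injective (add_left_injective 1) _
      _ ≤ (∑' i, (ENNReal.ofReal l₂ ^ s) ^ i) * G.cost p q c :=
          lqNorm_convolution_le hq _ fun k => lpSum p (G.cells k) fun Q => ‖c Q‖ₑ
      _ = ENNReal.ofReal (1 / (1 - l₂ ^ s)) * G.cost p q c := by
          rw [hG.ofReal_one_div_one_sub_rpow hs, ENNReal.tsum_geometric]

theorem oscNorm_le_besovNorm (hs : 0 < s) (hp : 1 ≤ p) (hq : 1 ≤ q)
    (hf : AEStronglyMeasurable f m) :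
    G.oscNorm s p q f ≤ G.oscConst l₂ s p q * G.besovNorm s p q f := by
  have hp0 : 0 < p := one_pos.trans_le hp
  have h0 : G.oscConst l₂ s p q ≠ 0 := by
    have : l₂ ^ s < 1 := Real.rpow_lt_one hG.l₂_pos.le hG.lt_one hs
    simp [oscConst, this]
  simp only [besovNorm, ENNReal.mul_iInf_of_ne h0 (hG.oscConst_lt_top hs hp0 hq).ne]
  refine le_iInf fun c => le_iInf fun a => le_iInf fun h => ?_
  obtain ⟨c', hc', h'⟩ := h.exists_canonical
  exact (hG.oscNorm_le_cost hs hp hq hf h').trans (by gcongr; exact cost_mono hp0.le hc')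

theorem besovNorm_lt_top_iff (hs : 0 < s) (hp : 1 ≤ p) (hq : 1 ≤ q)
    (hf : AEStronglyMeasurable f m) :
    G.besovNorm s p q f < ∞ ↔ f ∈ G.besovSpace s p q := by
  have hp0 : 0 < p := one_pos.trans_le hp
  simp only [besovNorm, iInf_lt_iff, besovSpace, Set.mem_ofPred_eq]
  refine ⟨fun ⟨c, a, h, hc⟩ => ⟨⟨hf, ?_⟩, c, a, h, hc⟩, fun ⟨_, c, a, h, hc⟩ => ⟨c, a, h, hc⟩⟩
  obtain ⟨c', hc', h'⟩ := h.exists_canonical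
  refine (hG.eLpNorm_le_cost hs.le hp hq hf h').trans_lt (ENNReal.mul_lt_top ?_ ?_)
  · exact hG.holderConst_mesh_lt_top hs hp0 hq
  · exact (cost_mono hp0.le hc').trans_lt hc

end Grid.IsGood

/-! ### The standard atomic representation -/

lemma integral_mul_sum_indicator {f : I → ℂ} (hf : Integrable f m) {F : Finset (Set I)}
    (hF : ∀ R ∈ F, MeasurableSet R) :
    Integrable (fun x => f x * ((∑ R ∈ F, R.indicator (fun _ => (1 : ℝ)) x : ℝ) : ℂ)) m ∧
      ∫ x, f x * ((∑ R ∈ F, R.indicator (fun _ => (1 : ℝ)) x : ℝ) : ℂ) ∂m =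
        ∑ R ∈ F, ∫ x in R, f x ∂m := by
  have sum_indicator : (fun x => f x * ((∑ R ∈ F, R.indicator (fun _ => (1 : ℝ)) x : ℝ) : ℂ)) =
      fun x => ∑ R ∈ F, R.indicator f x := by
    ext x
    rw [Complex.ofReal_sum, Finset.mul_sum]
    refine Finset.sum_congr rfl fun R _ => ?_
    by_cases hx : x ∈ R <;> simp [hx]
  have hint : ∀ R ∈ F, Integrable (R.indicator f) m := fun R hR => hf.indicator (hF R hR)
  rw [sum_indicator]
  refine ⟨integrable_finsetSum F hint, ?_⟩
  rw [integral_finsetSum F hint]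
  exact Finset.sum_congr rfl fun R hR => integral_indicator (hF R hR)

lemma haarCoeff_eq_discreteHaarCoeff {f : I → ℂ} (hf : Integrable f m)
    {S : Finset (Set I) × Finset (Set I)} (h₁ : ∀ R ∈ S.1, MeasurableSet R)
    (h₂ : ∀ R ∈ S.2, MeasurableSet R) :
    haarCoeff m f S = discreteHaarCoeff m.real (fun R => ∫ x in R, f x ∂m) S := by
  obtain ⟨int₁, eq₁⟩ := integral_mul_sum_indicator hf h₁
  obtain ⟨int₂, eq₂⟩ := integral_mul_sum_indicator hf h₂
  have mul_haarWavelet (x : I) : f x * (haarWavelet m S x : ℂ) =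
      haarFactor (∑ R ∈ S.1, m.real R) (∑ R ∈ S.2, m.real R) •
      ((∑ R ∈ S.1, m.real R)⁻¹ • (f x * ((∑ R ∈ S.1, R.indicator (fun _ => (1 : ℝ)) x : ℝ) : ℂ)) -
        (∑ R ∈ S.2, m.real R)⁻¹ •
          (f x * ((∑ R ∈ S.2, R.indicator (fun _ => (1 : ℝ)) x : ℝ) : ℂ))) := by
    simp only [haarWavelet, totalMeasure, haarFactor, Complex.real_smul]
    push_cast
    ring
  simp_rw [haarCoeff, mul_haarWavelet]
  rw [integral_smul, integral_sub (int₁.fun_smul _) (int₂.fun_smul _), integral_smul, integral_smul,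
    eq₁, eq₂, discreteHaarCoeff, cellMean, cellMean]

lemma haarCoeffTop_eq (m : Measure I) (f : I → ℂ) :
    haarCoeffTop m f = (∫ x, f x ∂m) * ((1 / m.real Set.univ ^ (1 / 2 : ℝ) : ℝ) : ℂ) :=
  integral_mul_const _ _

open Classical in
/-- The coefficients of the standard atomic representation as a function of the cell alone, which
determines its level. The value is `0` off the grid. -/
def Grid.stdFamily (G : Grid m) (D : G.Choices) (s p : ℝ) (f : I → ℂ) (Q : Set I) : ℂ :=
  if h : ∃ k, Q ∈ G.cells k then G.stdCoeff D s p f h.choose Q else 0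

lemma Grid.stdFamily_eq (D : G.Choices) (s p : ℝ) (f : I → ℂ) {k : ℕ} {Q : Set I}
    (hQ : Q ∈ G.cells k) : G.stdFamily D s p f Q = G.stdCoeff D s p f k Q := by
  have h : ∃ k, Q ∈ G.cells k := ⟨k, hQ⟩
  have hk : h.choose = k := by
    by_contra hne
    exact G.ne_of_ne _ _ hne Q h.choose_spec Q hQ rfl
  rw [stdFamily, dif_pos h, hk]

namespace Grid.IsGood

variable (hG : G.IsGood l₁ l₂)
include hG

lemma sum_indicator_eq_ite {n : ℕ} {F : Finset (Set I)} [DecidableEq (Set I)]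
    (hF : F ⊆ G.cells n) {P : Set I} (hP : P ∈ G.cells n) {x : I} (hx : x ∈ P) :
    ∑ R ∈ F, R.indicator (fun _ => (1 : ℝ)) x = if P ∈ F then 1 else 0 := by
  have eq_zero : ∀ R ∈ F, R ≠ P → R.indicator (fun _ => (1 : ℝ)) x = 0 := fun R hR hne =>
    Set.indicator_of_notMem (fun h => hne (hG.eq_of_mem (hF hR) hP h hx)) _
  split_ifs with h
  · rw [Finset.sum_eq_single_of_mem P h eq_zero, Set.indicator_of_mem hx]
  · exact Finset.sum_eq_zero fun R hR => eq_zero R hR (ne_of_mem_of_not_mem hR h)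

variable [IsFiniteMeasure m]

lemma exists_eq_halves (D : G.Choices) {k : ℕ} {Q : Set I} (hQ : Q ∈ G.cells k)
    {S : Finset (Set I) × Finset (Set I)} (hS : S ∈ G.haarFamily D k Q) :
    ∃ R ⊆ G.children k Q, 2 ≤ R.card ∧ S = halves D.order R :=
  D.isEnumeration.exists_eq_halves (hG.haarFamily_eq_splitPairs D hQ ▸ hS)

lemma subset_children_of_mem_haarFamily (D : G.Choices) {k : ℕ} {Q : Set I} (hQ : Q ∈ G.cells k)
    {S : Finset (Set I) × Finset (Set I)} (hS : S ∈ G.haarFamily D k Q) :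
    S.1 ⊆ G.children k Q ∧ S.2 ⊆ G.children k Q := by
  obtain ⟨R, hR, -, rfl⟩ := hG.exists_eq_halves D hQ hS
  exact ⟨(D.isEnumeration.halves_fst_subset R).trans hR,
    (D.isEnumeration.halves_snd_subset R).trans hR⟩

lemma haarCoeff_eq_of_mem_haarFamily (D : G.Choices) {f : I → ℂ} (hf : Integrable f m) {k : ℕ}
    {Q : Set I} (hQ : Q ∈ G.cells k) {S : Finset (Set I) × Finset (Set I)}
    (hS : S ∈ G.haarFamily D k Q) :
    haarCoeff m f S = discreteHaarCoeff m.real (fun R => ∫ x in R, f x ∂m) S := by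
  obtain ⟨h₁, h₂⟩ := hG.subset_children_of_mem_haarFamily D hQ hS
  exact haarCoeff_eq_discreteHaarCoeff hf (fun R hR => measurableSet_of_mem_descendants R (h₁ hR))
    (fun R hR => measurableSet_of_mem_descendants R (h₂ hR))

lemma haarWavelet_eq_discreteHaar (D : G.Choices) {k : ℕ} {Q P : Set I} (hQ : Q ∈ G.cells k)
    {S : Finset (Set I) × Finset (Set I)} (hS : S ∈ G.haarFamily D k Q) (hP : P ∈ G.children k Q)
    {x : I} (hx : x ∈ P) : haarWavelet m S x = discreteHaar m.real S P := by
  classical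
  obtain ⟨h₁, h₂⟩ := hG.subset_children_of_mem_haarFamily D hQ hS
  have sub : G.children k Q ⊆ G.cells (k + 1) := fun R hR => (mem_children.1 hR).1
  rw [haarWavelet, hG.sum_indicator_eq_ite (h₁.trans sub) (sub hP) hx,
    hG.sum_indicator_eq_ite (h₂.trans sub) (sub hP) hx, discreteHaar, haarFactor]
  rfl

lemma sum_haarCoeff_mul_haarWavelet (D : G.Choices) {f : I → ℂ} (hf : Integrable f m) {k : ℕ}
    {Q P : Set I} (hQ : Q ∈ G.cells k) (hP : P ∈ G.children k Q) {x : I} (hx : x ∈ P) :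
    ∑ S ∈ G.haarFamily D k Q, haarCoeff m f S * (haarWavelet m S x : ℂ) =
      ⨍ y in P, f y ∂m - ⨍ y in Q, f y ∂m := by
  have mul_eq : ∀ S ∈ G.haarFamily D k Q, haarCoeff m f S * (haarWavelet m S x : ℂ) =
      discreteHaar m.real S P • discreteHaarCoeff m.real (fun R => ∫ y in R, f y ∂m) S := by
    intro S hS
    rw [hG.haarCoeff_eq_of_mem_haarFamily D hf hQ hS,
      hG.haarWavelet_eq_discreteHaar D hQ hS hP hx, Complex.real_smul, mul_comm]
  have cellMean_children :
      cellMean m.real (fun R => ∫ y in R, f y ∂m) (G.children k Q) = ⨍ y in Q, f y ∂m := by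
    rw [setAverage_eq, cellMean, hG.setIntegral_eq_sum (Nat.le_succ k) hQ hf,
      hG.measureReal_eq_sum (Nat.le_succ k) hQ]
    rfl
  rw [Finset.sum_congr rfl mul_eq, hG.haarFamily_eq_splitPairs D hQ,
    sum_discreteHaar_smul_discreteHaarCoeff D.isEnumeration _
      (fun R hR => measureReal_pos (mem_children.1 hR).1) hP, cellMean_children,
    setAverage_eq _ f P]

omit [IsFiniteMeasure m] in
lemma filter_subset_eq_singleton {k : ℕ} {Q P : Set I} [DecidablePred fun Q : Set I => P ⊆ Q]
    (hQ : Q ∈ G.cells k) (hP : P ∈ G.children k Q) : {Q ∈ G.cells k | P ⊆ Q} = {Q} := by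
  obtain ⟨hPk, hPQ⟩ := mem_children.1 hP
  obtain ⟨x, hx⟩ := nonempty_of_mem_cells hPk
  refine Finset.eq_singleton_iff_unique_mem.2 ⟨Finset.mem_filter.2 ⟨hQ, hPQ⟩, fun R hR => ?_⟩
  obtain ⟨hR, hPR⟩ := Finset.mem_filter.1 hR
  exact hG.eq_of_mem hR hQ (hPR hx) (hPQ hx)

omit [IsFiniteMeasure m] in
lemma stdCoeff_succ_eq (D : G.Choices) (s p : ℝ) (f : I → ℂ) {k : ℕ} {Q P : Set I}
    (hQ : Q ∈ G.cells k) (hP : P ∈ G.children k Q) :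
    G.stdCoeff D s p f (k + 1) P = ((1 / m.real P ^ (s - 1 / p) : ℝ) : ℂ) *
      ∑ S ∈ G.haarFamily D k Q, haarCoeff m f S * (haarWavelet m S (D.pt P) : ℂ) := by
  classical
  rw [stdCoeff, hG.filter_subset_eq_singleton hQ hP, Finset.sum_singleton]

lemma stdCoeff_zero_mul (D : G.Choices) (s p : ℝ) (f : I → ℂ) (Q : Set I) :
    G.stdCoeff D s p f 0 Q * ((m.real Set.univ ^ (s - 1 / p) : ℝ) : ℂ) =
      ⨍ x in Set.univ, f x ∂m := by
  have hpos : 0 < m.real Set.univ := measureReal_pos hG.univ_mem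
  have exponents : m.real Set.univ ^ (1 / p - s - 1 / 2) * (1 / m.real Set.univ ^ (1 / 2 : ℝ)) *
      m.real Set.univ ^ (s - 1 / p) = (m.real Set.univ)⁻¹ := by
    rw [one_div (m.real Set.univ ^ _), ← Real.rpow_neg hpos.le, ← Real.rpow_add hpos,
      ← Real.rpow_add hpos, ← Real.rpow_neg_one]
    ring_nf
  rw [stdCoeff, haarCoeffTop_eq, setAverage_eq, setIntegral_univ, ← exponents, Complex.real_smul]
  push_cast
  ring

lemma stdCoeff_succ_mul (D : G.Choices) (s p : ℝ) {f : I → ℂ} (hf : Integrable f m) {k : ℕ}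
    {Q P : Set I} (hQ : Q ∈ G.cells k) (hP : P ∈ G.children k Q) :
    G.stdCoeff D s p f (k + 1) P * ((m.real P ^ (s - 1 / p) : ℝ) : ℂ) =
      ⨍ x in P, f x ∂m - ⨍ x in Q, f x ∂m := by
  have hPk := (mem_children.1 hP).1
  have hne : ((m.real P ^ (s - 1 / p) : ℝ) : ℂ) ≠ 0 := by
    exact_mod_cast (Real.rpow_pos_of_pos (measureReal_pos hPk) _).ne'
  rw [hG.stdCoeff_succ_eq D s p f hQ hP,
    hG.sum_haarCoeff_mul_haarWavelet D hf hQ hP (D.pt_mem _ P hPk), mul_right_comm,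
    Complex.ofReal_div, Complex.ofReal_one, one_div_mul_cancel hne, one_mul]

/-- The partial sums of the standard atomic representation are the averages of `f`. -/
lemma sum_canonicalBlock_stdFamily (D : G.Choices) (s p : ℝ) {f : I → ℂ} (hf : Integrable f m)
    (n : ℕ) {P : Set I} (hP : P ∈ G.cells n) {x : I} (hx : x ∈ P) :
    ∑ k ∈ Finset.range (n + 1), G.canonicalBlock s p (G.stdFamily D s p f) k x =
      G.average f n x := by
  induction n generalizing P with
  | zero =>
    obtain rfl : P = Set.univ := by simpa [hG.cells_zero] using hP
    rw [Finset.sum_range_one, canonicalBlock, hG.stepFun_eq hP hx, hG.average_eq hP hx,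
      stdFamily_eq D s p f hP, hG.stdCoeff_zero_mul]
  | succ n ih =>
    obtain ⟨Q, hQ, hPQ⟩ := hG.exists_parent n P hP
    rw [Finset.sum_range_succ, ih hQ (hPQ hx), canonicalBlock, hG.stepFun_eq hP hx,
      hG.average_eq hP hx, hG.average_eq hQ (hPQ hx), stdFamily_eq D s p f hP,
      hG.stdCoeff_succ_mul D s p hf hQ (mem_children.2 ⟨hP, hPQ⟩), add_sub_cancel]

omit [IsFiniteMeasure m] in
lemma cost_stdFamily_le (D : G.Choices) {s p : ℝ} (hp : 0 < p) {q : ℝ≥0∞} (hq : 1 ≤ q)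
    (f : I → ℂ) : G.cost p q (G.stdFamily D s p f) ≤ G.stdNorm D s p q f := by
  refine (lqNorm_le_head_add hq _).trans (add_le_add (le_of_eq ?_) (le_of_eq ?_))
  · rw [hG.cells_zero, lpSum, Finset.sum_singleton, one_div, ENNReal.rpow_rpow_inv hp.ne',
      stdFamily_eq D s p f hG.univ_mem]
  · refine congrArg (lqNorm q) (funext fun k => congrArg (· ^ (1 / p)) ?_)
    exact Finset.sum_congr rfl fun Q hQ => by simp only [stdFamily_eq D s p f hQ]

lemma isRepresentation_stdFamily (D : G.Choices) {s p : ℝ} (hs : 0 < s) (hp : 1 ≤ p) {q : ℝ≥0∞}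
    (hq : 1 ≤ q) {f : I → ℂ} (hf : Integrable f m) (hc : G.cost p q (G.stdFamily D s p f) < ∞) :
    G.IsRepresentation s p (G.stdFamily D s p f) (canonicalAtom m s p) f := by
  have hp0 : 0 < p := one_pos.trans_le hp
  set B := G.canonicalBlock s p (G.stdFamily D s p f) with hB
  have abs_conv : ∑' k, eLpNorm (B k) (ENNReal.ofReal p) m < ∞ :=
    (hG.tsum_eLpNorm_canonicalBlock_le hs.le hp0 hq _).trans_lt
      (ENNReal.mul_lt_top (hG.holderConst_mesh_lt_top hs hp0 hq) hc)
  have ae_tendsto : ∀ᵐ x ∂m, Tendsto (fun n => ∑ k ∈ Finset.range n, B k x) atTop (𝓝 (f x)) := by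
    filter_upwards [hG.ae_tendsto_average hf, ae_all_iff.2 fun n => hG.ae_exists_mem n]
      with x hx mem_cells
    rw [← tendsto_add_atTop_iff_nat 1]
    refine hx.congr fun n => ?_
    obtain ⟨P, hP, hxP⟩ := mem_cells n
    exact (hG.sum_canonicalBlock_stdFamily D s p hf n hP hxP).symm
  refine ⟨fun k Q hQ => isSouzaAtom_canonicalAtom (G.measure_pos k Q hQ).ne', ?_, ?_⟩
  · simpa only [block_canonicalAtom, ← hB] using abs_conv
  · simp only [block_canonicalAtom, ← hB]
    refine tendsto_of_tendsto_of_tendsto_of_le_of_le tendsto_const_nhds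
      (ENNReal.tendsto_sum_nat_add _ abs_conv.ne) (fun _ => zero_le) fun n => ?_
    have := eLpNorm_sub_sum_le_tsum_of_ae_tendsto (g := B) (ENNReal.one_le_ofReal.2 hp)
      (fun k => aestronglyMeasurable_stepFun k _) ae_tendsto n
    simpa only [add_comm n] using this

theorem besovNorm_le_stdNorm (D : G.Choices) {s p : ℝ} (hs : 0 < s) (hp : 1 ≤ p) {q : ℝ≥0∞}
    (hq : 1 ≤ q) {f : I → ℂ} (hf : Integrable f m) :
    G.besovNorm s p q f ≤ G.stdNorm D s p q f := by
  obtain h | h := eq_or_ne (G.stdNorm D s p q f) ∞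
  · exact h ▸ le_top
  · have hc := hG.cost_stdFamily_le D (s := s) (one_pos.trans_le hp) hq f
    exact (iInf₂_le_of_le _ _ (iInf_le _
      (hG.isRepresentation_stdFamily D hs hp hq hf (hc.trans_lt h.lt_top)))).trans hc

end Grid.IsGood

/-! ### Comparison of the norms -/

lemma one_le_waveletConst (h₁ : 0 < l₁) (h₂ : 0 < l₂) : 1 ≤ waveletConst l₁ l₂ :=
  le_add_of_nonneg_left (by positivity)

lemma one_le_stdConst (h₁ : 0 < l₁) (h₂ : 0 < l₂) (s p : ℝ) : 1 ≤ stdConst l₁ l₂ s p :=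
  have hK : 0 < waveletConst l₁ l₂ := one_pos.trans_le (one_le_waveletConst h₁ h₂)
  le_add_of_nonneg_right (by positivity)

lemma clog_two_le (n : ℕ) : Nat.clog 2 n ≤ (n + 1) / 2 := by
  refine Nat.clog_le_of_le_pow ?_
  obtain hn | ⟨k, hk⟩ : n = 0 ∨ ∃ k, (n + 1) / 2 = k + 1 := by
    rcases n with _ | n
    · exact .inl rfl
    · exact .inr ⟨n / 2, by omega⟩
  · simp [hn]
  · have : k < 2 ^ k := Nat.lt_two_pow_self
    rw [hk, pow_succ]
    omega

lemma card_div_le_waveletConst_sq {n : ℝ} (h₁ : 0 < l₁) (h₂ : 0 < l₂) (hn₁ : n * l₁ ≤ 1)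
    (hn₂ : 1 ≤ n * l₂) : (n + 1) / 2 / l₁ ≤ waveletConst l₁ l₂ ^ 2 := by
  set A := l₂ ^ (1 / 2 : ℝ) / (√2 * l₁ ^ (3 / 2 : ℝ)) with hA
  have hA0 : 0 ≤ A := by positivity
  have hA2 : A ^ 2 = l₂ / (2 * l₁ ^ 3) := by
    rw [hA, div_pow, mul_pow, Real.sq_sqrt (by norm_num), ← Real.rpow_natCast, ← Real.rpow_natCast,
      ← Real.rpow_mul h₂.le, ← Real.rpow_mul h₁.le]
    norm_num
  have hl : l₁ ≤ l₂ := by nlinarith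
  have hn : n / (2 * l₁) ≤ A ^ 2 := by
    rw [hA2, div_le_div_iff₀ (by positivity) (by positivity)]
    nlinarith [mul_nonneg h₁.le h₁.le, mul_le_mul_of_nonneg_right hn₁ (mul_nonneg h₁.le h₁.le)]
  have h1 : 1 / (2 * l₁) ≤ A := by
    refine (sq_le_sq₀ (by positivity) hA0).1 ?_
    rw [hA2, div_pow, one_pow, mul_pow, div_le_div_iff₀ (by positivity) (by positivity)]
    nlinarith [mul_nonneg h₁.le h₁.le]
  calc (n + 1) / 2 / l₁ = n / (2 * l₁) + 1 / (2 * l₁) := by field_simp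
    _ ≤ (A + 1) ^ 2 := by nlinarith
    _ = waveletConst l₁ l₂ ^ 2 := by rw [waveletConst, ← hA]

lemma rpow_le_max_of_mem_Icc {a b t : ℝ} (ha : 0 < a) (ht : t ∈ Set.Icc a b) (r : ℝ) :
    t ^ r ≤ max (b ^ r) (a ^ r) := by
  rcases le_total 0 r with hr | hr
  · exact le_max_of_le_left (Real.rpow_le_rpow (ha.le.trans ht.1) ht.2 hr)
  · exact le_max_of_le_right (Real.rpow_le_rpow_of_nonpos ha ht.1 hr)

lemma setLIntegral_enorm_le_mul_eLpNorm {p : ℝ} (hp : 1 ≤ p) {f : I → ℂ}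
    (hf : AEStronglyMeasurable f m) (Q : Set I) :
    ∫⁻ x in Q, ‖f x‖ₑ ∂m ≤ m Q ^ (1 - 1 / p) * eLpNorm f (ENNReal.ofReal p) (m.restrict Q) := by
  rw [← eLpNorm_one_eq_lintegral_enorm, mul_comm]
  simpa [ENNReal.toReal_ofReal (zero_le_one.trans hp)] using
    eLpNorm_le_eLpNorm_mul_rpow_measure_univ (ENNReal.one_le_ofReal.2 hp) hf.restrict

lemma Grid.haarNorm_eq {p : ℝ} (hp : 0 < p) (D : G.Choices) (s : ℝ) (q : ℝ≥0∞) (f : I → ℂ) :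
    G.haarNorm D s p q f = m Set.univ ^ (1 / p - s - 1 / 2) * ‖haarCoeffTop m f‖ₑ +
      lqNorm q fun k => lpSum p (G.cells k) fun Q =>
        m Q ^ (1 / p - s - 1 / 2) * lpSum p (G.haarFamily D k Q) fun S => ‖haarCoeff m f S‖ₑ := by
  have exponent_eq : (1 / p - s - 1 / 2) * p = 1 - s * p - p / 2 := by field_simp
  simp only [haarNorm, lpSum, ENNReal.mul_rpow_of_nonneg _ _ hp.le, ← ENNReal.rpow_mul,
    exponent_eq, one_div_mul_cancel hp.ne', ENNReal.rpow_one]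

namespace Grid.IsGood

variable (hG : G.IsGood l₁ l₂) [IsFiniteMeasure m]
include hG

lemma sum_abs_discreteHaar_le (D : G.Choices) {k : ℕ} {Q P : Set I} (hQ : Q ∈ G.cells k)
    (hP : P ∈ G.children k Q) :
    ∑ S ∈ G.haarFamily D k Q, |discreteHaar m.real S P| ≤
      waveletConst l₁ l₂ * m.real Q ^ (-(1 / 2) : ℝ) := by
  have hQ0 : 0 < m.real Q := measureReal_pos hQ
  have hK : 1 ≤ waveletConst l₁ l₂ := one_le_waveletConst hG.pos hG.l₂_pos
  have l₁_pos : 0 < l₁ := hG.pos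
  refine (sq_le_sq₀ (Finset.sum_nonneg fun _ _ => abs_nonneg _) (by positivity)).1 ?_
  rw [hG.haarFamily_eq_splitPairs D hQ]
  set n := (G.children k Q).card
  have hclog : (Nat.clog 2 n : ℝ) ≤ (n + 1) / 2 :=
    (Nat.cast_le.2 (clog_two_le n)).trans (Nat.cast_div_le.trans_eq (by push_cast; rfl))
  calc _ ≤ Nat.clog 2 n * (m.real P)⁻¹ := sum_abs_discreteHaar_sq_le D.isEnumeration
        (fun R hR => measureReal_pos (mem_children.1 hR).1) hP
    _ ≤ (n + 1) / 2 * (l₁ * m.real Q)⁻¹ := by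
        gcongr
        exact hG.mul_measureReal_le_of_mem_children hQ hP
    _ = (n + 1) / 2 / l₁ * (m.real Q)⁻¹ := by field_simp
    _ ≤ waveletConst l₁ l₂ ^ 2 * (m.real Q)⁻¹ := by
        gcongr
        exact card_div_le_waveletConst_sq hG.pos hG.l₂_pos (hG.card_children_mul_le_one hQ)
          (hG.one_le_card_children_mul hQ)
    _ = (waveletConst l₁ l₂ * m.real Q ^ (-(1 / 2) : ℝ)) ^ 2 := by
        rw [mul_pow, ← Real.rpow_natCast (m.real Q ^ _), ← Real.rpow_mul hQ0.le]
        norm_num [Real.rpow_neg_one]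

lemma haarCoeff_eq_sum (D : G.Choices) {f : I → ℂ} (hf : Integrable f m) (c : ℂ) {k : ℕ}
    {Q : Set I} (hQ : Q ∈ G.cells k) {S : Finset (Set I) × Finset (Set I)}
    (hS : S ∈ G.haarFamily D k Q) :
    haarCoeff m f S =
      ∑ P ∈ G.children k Q, discreteHaar m.real S P • ∫ x in P, (f x - c) ∂m := by
  obtain ⟨h₁, h₂⟩ := hG.subset_children_of_mem_haarFamily D hQ hS
  have integral_sub_const (P : Set I) :
      ∫ x in P, (f x - c) ∂m = ∫ x in P, f x ∂m - m.real P • c := by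
    rw [integral_sub hf.integrableOn (integrable_const c), setIntegral_const]
  obtain ⟨R, -, hcard, rfl⟩ := hG.exists_eq_halves D hQ hS
  have sum_ne_zero {T : Finset (Set I)} (hT : T ⊆ G.children k Q) (hne : T.Nonempty) :
      ∑ P ∈ T, m.real P ≠ 0 :=
    (Finset.sum_pos (fun P hP => measureReal_pos (mem_children.1 (hT hP)).1) hne).ne'
  rw [hG.haarCoeff_eq_of_mem_haarFamily D hf hQ hS,
    ← discreteHaarCoeff_sub_smul (sum_ne_zero h₁ (D.isEnumeration.halves_fst_nonempty hcard))
      (sum_ne_zero h₂ (D.isEnumeration.halves_snd_nonempty hcard)) _ c,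
    discreteHaarCoeff_eq_sum _ _ h₁ h₂]
  simp only [integral_sub_const]

lemma sum_norm_haarCoeff_le (D : G.Choices) {f : I → ℂ} (hf : Integrable f m) (c : ℂ) {k : ℕ}
    {Q : Set I} (hQ : Q ∈ G.cells k) :
    ∑ S ∈ G.haarFamily D k Q, ‖haarCoeff m f S‖ ≤
      waveletConst l₁ l₂ * m.real Q ^ (-(1 / 2) : ℝ) * ∫ x in Q, ‖f x - c‖ ∂m := by
  calc ∑ S ∈ G.haarFamily D k Q, ‖haarCoeff m f S‖
      ≤ ∑ S ∈ G.haarFamily D k Q, ∑ P ∈ G.children k Q,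
          |discreteHaar m.real S P| * ∫ x in P, ‖f x - c‖ ∂m := by
        gcongr with S hS
        rw [hG.haarCoeff_eq_sum D hf c hQ hS]
        refine norm_sum_le_of_le _ fun P _ => ?_
        rw [norm_smul, Real.norm_eq_abs]
        gcongr
        exact norm_integral_le_integral_norm _
    _ = ∑ P ∈ G.children k Q, (∑ S ∈ G.haarFamily D k Q, |discreteHaar m.real S P|) *
          ∫ x in P, ‖f x - c‖ ∂m := by
        rw [Finset.sum_comm]
        simp only [Finset.sum_mul]
    _ ≤ ∑ P ∈ G.children k Q, waveletConst l₁ l₂ * m.real Q ^ (-(1 / 2) : ℝ) *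
          ∫ x in P, ‖f x - c‖ ∂m := by
        gcongr with P hP
        exact hG.sum_abs_discreteHaar_le D hQ hP
    _ = waveletConst l₁ l₂ * m.real Q ^ (-(1 / 2) : ℝ) * ∫ x in Q, ‖f x - c‖ ∂m := by
        rw [← Finset.mul_sum]
        exact congrArg _ (hG.setIntegral_eq_sum (Nat.le_succ k) hQ
          (hf.sub (integrable_const c)).norm).symm

lemma sum_enorm_haarCoeff_le (D : G.Choices) {f : I → ℂ} (hf : Integrable f m) (c : ℂ) {k : ℕ}
    {Q : Set I} (hQ : Q ∈ G.cells k) :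
    ∑ S ∈ G.haarFamily D k Q, ‖haarCoeff m f S‖ₑ ≤
      ENNReal.ofReal (waveletConst l₁ l₂) * m Q ^ (-(1 / 2) : ℝ) * ∫⁻ x in Q, ‖f x - c‖ₑ ∂m := by
  have hK : 0 ≤ waveletConst l₁ l₂ := zero_le_one.trans (one_le_waveletConst hG.pos hG.l₂_pos)
  have hfc : Integrable (fun x => f x - c) m := hf.sub (integrable_const c)
  have h := ENNReal.ofReal_le_ofReal (hG.sum_norm_haarCoeff_le D hf c hQ)
  rwa [ENNReal.ofReal_sum_of_nonneg fun _ _ => norm_nonneg _, ENNReal.ofReal_mul (by positivity),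
    ENNReal.ofReal_mul hK, ← ENNReal.ofReal_rpow_of_pos (measureReal_pos hQ),
    ofReal_measureReal (measure_ne_top _ _),
    ofReal_integral_norm_eq_lintegral_enorm hfc.integrableOn,
    Finset.sum_congr rfl fun S _ => ofReal_norm (haarCoeff m f S)] at h

lemma lpSum_haarCoeff_le_osc (D : G.Choices) {p : ℝ} (hp : 1 ≤ p) {f : I → ℂ}
    (hf : Integrable f m) {k : ℕ} {Q : Set I} (hQ : Q ∈ G.cells k) :
    lpSum p (G.haarFamily D k Q) (fun S => ‖haarCoeff m f S‖ₑ) ≤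
      ENNReal.ofReal (waveletConst l₁ l₂) * m Q ^ (1 / 2 - 1 / p) * osc m p f Q := by
  have hK : 0 < waveletConst l₁ l₂ := one_pos.trans_le (one_le_waveletConst hG.pos hG.l₂_pos)
  have hQ0 : m Q ≠ 0 := (G.measure_pos k Q hQ).ne'
  have hC0 : ENNReal.ofReal (waveletConst l₁ l₂) * m Q ^ (1 / 2 - 1 / p) ≠ 0 :=
    mul_ne_zero (ENNReal.ofReal_pos.2 hK).ne'
      (ENNReal.rpow_pos (G.measure_pos k Q hQ) (measure_ne_top _ _)).ne'
  have hCtop : ENNReal.ofReal (waveletConst l₁ l₂) * m Q ^ (1 / 2 - 1 / p) ≠ ∞ :=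
    ENNReal.mul_ne_top ENNReal.ofReal_ne_top
      (ENNReal.rpow_ne_top_of_ne_zero hQ0 (measure_ne_top _ _))
  have exponent_add : -(1 / 2) + (1 - 1 / p) = 1 / 2 - 1 / p := by ring
  rw [osc, ENNReal.mul_iInf_of_ne hC0 hCtop]
  refine le_iInf fun c => ?_
  rw [← eLpNorm_ofReal (one_pos.trans_le hp) fun x => f x - c]
  calc lpSum p (G.haarFamily D k Q) (fun S => ‖haarCoeff m f S‖ₑ)
      ≤ ∑ S ∈ G.haarFamily D k Q, ‖haarCoeff m f S‖ₑ := lpSum_le_sum _ hp _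
    _ ≤ ENNReal.ofReal (waveletConst l₁ l₂) * m Q ^ (-(1 / 2) : ℝ) *
          ∫⁻ x in Q, ‖f x - c‖ₑ ∂m := hG.sum_enorm_haarCoeff_le D hf c hQ
    _ ≤ ENNReal.ofReal (waveletConst l₁ l₂) * m Q ^ (-(1 / 2) : ℝ) *
          (m Q ^ (1 - 1 / p) * eLpNorm (fun x => f x - c) (ENNReal.ofReal p) (m.restrict Q)) := by
        gcongr
        exact setLIntegral_enorm_le_mul_eLpNorm hp (hf.1.sub aestronglyMeasurable_const) Q
    _ = ENNReal.ofReal (waveletConst l₁ l₂) * m Q ^ (1 / 2 - 1 / p) *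
          eLpNorm (fun x => f x - c) (ENNReal.ofReal p) (m.restrict Q) := by
        rw [← mul_assoc, mul_assoc (ENNReal.ofReal _), ← ENNReal.rpow_add _ _ hQ0
          (measure_ne_top _ _), exponent_add]

lemma enorm_haarCoeffTop_le {p : ℝ} (hp : 1 ≤ p) {f : I → ℂ} (hf : AEStronglyMeasurable f m) :
    ‖haarCoeffTop m f‖ₑ ≤ m Set.univ ^ (1 / 2 - 1 / p) * eLpNorm f (ENNReal.ofReal p) m := by
  have hI0 : m Set.univ ≠ 0 := hG.measure_univ_pos.ne'
  calc ‖haarCoeffTop m f‖ₑ = ‖∫ x, f x ∂m‖ₑ * m Set.univ ^ (-(1 / 2) : ℝ) := by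
        rw [haarCoeffTop_eq, enorm_mul, one_div, ← Real.rpow_neg measureReal_nonneg,
          enorm_measureReal_rpow hI0]
    _ ≤ m Set.univ ^ (1 - 1 / p) * eLpNorm f (ENNReal.ofReal p) m *
          m Set.univ ^ (-(1 / 2) : ℝ) := by
        gcongr
        refine (enorm_integral_le_lintegral_enorm f).trans ?_
        simpa using setLIntegral_enorm_le_mul_eLpNorm hp hf Set.univ
    _ = m Set.univ ^ (1 / 2 - 1 / p) * eLpNorm f (ENNReal.ofReal p) m := by
        rw [mul_right_comm, ← ENNReal.rpow_add _ _ hI0 (measure_ne_top _ _)]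
        ring_nf

theorem haarNorm_le_oscNorm (D : G.Choices) {s p : ℝ} (hp : 1 ≤ p) {q : ℝ≥0∞} (hq : 1 ≤ q)
    {f : I → ℂ} (hf : Integrable f m) :
    G.haarNorm D s p q f ≤ ENNReal.ofReal (waveletConst l₁ l₂) * G.oscNorm s p q f := by
  have hp0 : 0 < p := one_pos.trans_le hp
  have merge_powers {k : ℕ} {Q : Set I} (hQ : Q ∈ G.cells k) :
      m Q ^ (1 / p - s - 1 / 2) * m Q ^ (1 / 2 - 1 / p) = m Q ^ (-s) := by
    rw [← ENNReal.rpow_add _ _ (G.measure_pos k Q hQ).ne' (measure_ne_top _ _)]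
    ring_nf
  rw [haarNorm_eq hp0, oscNorm_eq hp0, mul_add, ← lqNorm_const_mul (one_pos.trans_le hq).ne']
  refine add_le_add ?_ (lqNorm_mono fun k => ?_)
  · calc m Set.univ ^ (1 / p - s - 1 / 2) * ‖haarCoeffTop m f‖ₑ
        ≤ m Set.univ ^ (1 / p - s - 1 / 2) *
            (m Set.univ ^ (1 / 2 - 1 / p) * eLpNorm f (ENNReal.ofReal p) m) := by
          gcongr
          exact hG.enorm_haarCoeffTop_le hp hf.1
      _ = 1 * (m Set.univ ^ (-s) * eLpNorm f (ENNReal.ofReal p) m) := by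
          rw [← mul_assoc, merge_powers hG.univ_mem, one_mul]
      _ ≤ _ := by
          gcongr
          exact ENNReal.one_le_ofReal.2 (one_le_waveletConst hG.pos hG.l₂_pos)
  · rw [← lpSum_const_mul _ hp0]
    refine lpSum_mono _ hp0.le fun Q hQ => ?_
    calc m Q ^ (1 / p - s - 1 / 2) * lpSum p (G.haarFamily D k Q) (fun S => ‖haarCoeff m f S‖ₑ)
        ≤ m Q ^ (1 / p - s - 1 / 2) *
            (ENNReal.ofReal (waveletConst l₁ l₂) * m Q ^ (1 / 2 - 1 / p) * osc m p f Q) := by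
          gcongr
          exact hG.lpSum_haarCoeff_le_osc D hp hf hQ
      _ = ENNReal.ofReal (waveletConst l₁ l₂) * (m Q ^ (-s) * osc m p f Q) := by
          rw [← merge_powers hQ]
          ring

lemma measureReal_rpow_le_of_mem_children (r : ℝ) {k : ℕ} {Q P : Set I} (hQ : Q ∈ G.cells k)
    (hP : P ∈ G.children k Q) : m.real P ^ r ≤ max (l₂ ^ r) (l₁ ^ r) * m.real Q ^ r := by
  have hQ0 : 0 < m.real Q := measureReal_pos hQ
  obtain ⟨hPk, hPQ⟩ := mem_children.1 hP
  rw [← div_le_iff₀ (by positivity), ← Real.div_rpow measureReal_nonneg hQ0.le]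
  exact rpow_le_max_of_mem_Icc hG.pos (hG.ratio k P hPk Q hQ hPQ) r

lemma sum_norm_haarWavelet_le (D : G.Choices) {k : ℕ} {Q P : Set I} (hQ : Q ∈ G.cells k)
    (hP : P ∈ G.children k Q) {x : I} (hx : x ∈ P) :
    ∑ S ∈ G.haarFamily D k Q, ‖haarWavelet m S x‖ ≤
      waveletConst l₁ l₂ * m.real Q ^ (-(1 / 2) : ℝ) := by
  refine (Finset.sum_congr rfl fun S hS => ?_).trans_le (hG.sum_abs_discreteHaar_le D hQ hP)
  rw [Real.norm_eq_abs, hG.haarWavelet_eq_discreteHaar D hQ hS hP hx]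

lemma rpow_mul_sum_norm_haarWavelet_le (D : G.Choices) (r : ℝ) {k : ℕ} {Q P : Set I}
    (hQ : Q ∈ G.cells k) (hP : P ∈ G.children k Q) {x : I} (hx : x ∈ P) :
    ENNReal.ofReal (m.real P ^ r) * ∑ S ∈ G.haarFamily D k Q, ‖(haarWavelet m S x : ℂ)‖ₑ ≤
      ENNReal.ofReal (waveletConst l₁ l₂ * max (l₂ ^ r) (l₁ ^ r)) * m Q ^ (r - 1 / 2) := by
  have l₁_pos : 0 < l₁ := hG.pos
  have hQ0 : 0 < m.real Q := measureReal_pos hQ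
  have hK : 0 < waveletConst l₁ l₂ := one_pos.trans_le (one_le_waveletConst hG.pos hG.l₂_pos)
  have real_le : m.real P ^ r * ∑ S ∈ G.haarFamily D k Q, ‖haarWavelet m S x‖ ≤
      waveletConst l₁ l₂ * max (l₂ ^ r) (l₁ ^ r) * m.real Q ^ (r - 1 / 2) := by
    calc _ ≤ max (l₂ ^ r) (l₁ ^ r) * m.real Q ^ r *
          (waveletConst l₁ l₂ * m.real Q ^ (-(1 / 2) : ℝ)) := by
          gcongr
          · exact hG.measureReal_rpow_le_of_mem_children r hQ hP
          · exact hG.sum_norm_haarWavelet_le D hQ hP hx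
      _ = _ := by
          rw [sub_eq_add_neg, Real.rpow_add hQ0]
          ring
  have h := ENNReal.ofReal_le_ofReal real_le
  rwa [ENNReal.ofReal_mul (by positivity), ENNReal.ofReal_mul (by positivity),
    ENNReal.ofReal_sum_of_nonneg fun _ _ => norm_nonneg _, ← ENNReal.ofReal_rpow_of_pos hQ0,
    ofReal_measureReal (measure_ne_top m Q),
    Finset.sum_congr rfl fun S _ => (by rw [← Complex.norm_real, ofReal_norm] :
      ENNReal.ofReal ‖haarWavelet m S x‖ = ‖(haarWavelet m S x : ℂ)‖ₑ)] at h

lemma enorm_stdCoeff_le (D : G.Choices) (s : ℝ) {p : ℝ} (hp : 0 < p) (f : I → ℂ) {k : ℕ}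
    {Q P : Set I} (hQ : Q ∈ G.cells k) (hP : P ∈ G.children k Q) :
    ‖G.stdCoeff D s p f (k + 1) P‖ₑ ≤
      ENNReal.ofReal (waveletConst l₁ l₂ * max (l₂ ^ (1 / p - s)) (l₁ ^ (1 / p - s))) *
        (m Q ^ (1 / p - s - 1 / 2) *
          lpSum p (G.haarFamily D k Q) fun S => ‖haarCoeff m f S‖ₑ) := by
  have pt_mem : D.pt P ∈ P := D.pt_mem _ P (mem_children.1 hP).1
  calc ‖G.stdCoeff D s p f (k + 1) P‖ₑ
      = ‖((m.real P ^ (1 / p - s) : ℝ) : ℂ)‖ₑ *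
          ‖∑ S ∈ G.haarFamily D k Q, haarCoeff m f S * (haarWavelet m S (D.pt P) : ℂ)‖ₑ := by
        rw [hG.stdCoeff_succ_eq D s p f hQ hP, enorm_mul, one_div (m.real P ^ _),
          ← Real.rpow_neg measureReal_nonneg, neg_sub]
    _ ≤ ENNReal.ofReal (m.real P ^ (1 / p - s)) *
          ((∑ S ∈ G.haarFamily D k Q, ‖(haarWavelet m S (D.pt P) : ℂ)‖ₑ) *
            lpSum p (G.haarFamily D k Q) fun S => ‖haarCoeff m f S‖ₑ) := by
        rw [← ofReal_norm, Complex.norm_real, Real.norm_of_nonneg (by positivity)]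
        gcongr
        refine (enorm_sum_le _ _).trans ?_
        simp only [enorm_mul, mul_comm (‖haarCoeff m f _‖ₑ)]
        exact sum_mul_le_sum_mul_lpSum _ hp _ _
    _ ≤ _ := by
        rw [← mul_assoc, ← mul_assoc]
        exact mul_le_mul' (hG.rpow_mul_sum_norm_haarWavelet_le D _ hQ hP pt_mem) le_rfl

lemma lpSum_cells_succ_le {p : ℝ} (hp : 0 < p) {k : ℕ} {a b : Set I → ℝ≥0∞}
    (h : ∀ Q ∈ G.cells k, ∀ P ∈ G.children k Q, a P ≤ b Q) :
    lpSum p (G.cells (k + 1)) a ≤ ENNReal.ofReal (l₁ ^ (-1 / p)) * lpSum p (G.cells k) b := by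
  have card_le {Q : Set I} (hQ : Q ∈ G.cells k) :
      ((G.children k Q).card : ℝ≥0∞) ≤ ENNReal.ofReal (l₁ ^ (-1 / p)) ^ p := by
    have card_le_inv : ((G.children k Q).card : ℝ) ≤ l₁⁻¹ := by
      rw [← one_div, le_div_iff₀ hG.pos]
      exact hG.card_children_mul_le_one hQ
    rw [ENNReal.ofReal_rpow_of_pos (Real.rpow_pos_of_pos hG.pos _), ← Real.rpow_mul hG.pos.le,
      div_mul_cancel₀ _ hp.ne', Real.rpow_neg_one, ← ENNReal.ofReal_natCast]
    exact ENNReal.ofReal_le_ofReal card_le_inv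
  rw [← lpSum_const_mul _ hp, lpSum, lpSum, ← hG.sum_sum_descendants (Nat.le_succ k)]
  gcongr with Q hQ
  calc ∑ P ∈ G.children k Q, a P ^ p ≤ (G.children k Q).card * b Q ^ p := by
        rw [← nsmul_eq_mul]
        exact Finset.sum_le_card_nsmul _ _ _ fun P hP =>
          ENNReal.rpow_le_rpow (h Q hQ P hP) hp.le
    _ ≤ (ENNReal.ofReal (l₁ ^ (-1 / p)) * b Q) ^ p := by
        rw [ENNReal.mul_rpow_of_nonneg _ _ hp.le]
        gcongr
        exact card_le hQ

theorem stdNorm_le_haarNorm (D : G.Choices) (s : ℝ) {p : ℝ} (hp : 0 < p) {q : ℝ≥0∞} (hq : q ≠ 0)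
    (f : I → ℂ) :
    G.stdNorm D s p q f ≤ ENNReal.ofReal (stdConst l₁ l₂ s p) * G.haarNorm D s p q f := by
  have hK : 0 < waveletConst l₁ l₂ := one_pos.trans_le (one_le_waveletConst hG.pos hG.l₂_pos)
  have l₁_pos : 0 < l₁ := hG.pos
  have const_le : l₁ ^ (-1 / p) *
      (waveletConst l₁ l₂ * max (l₂ ^ (1 / p - s)) (l₁ ^ (1 / p - s))) ≤ stdConst l₁ l₂ s p := by
    have rpow_le : l₁ ^ (-1 / p) ≤ l₁ ^ (-2 - 1 / p) :=
      Real.rpow_le_rpow_of_exponent_ge hG.pos (hG.lt.trans hG.lt_one).le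
        (by rw [neg_div]; linarith)
    rw [stdConst, mul_comm]
    exact le_add_of_nonneg_of_le zero_le_one (by gcongr)
  rw [stdNorm, haarNorm_eq hp, mul_add, ← lqNorm_const_mul hq]
  refine add_le_add ?_ (lqNorm_mono fun k => ?_)
  · rw [stdCoeff, enorm_mul, enorm_measureReal_rpow hG.measure_univ_pos.ne']
    exact le_mul_of_one_le_left zero_le
      (ENNReal.one_le_ofReal.2 (one_le_stdConst hG.pos hG.l₂_pos s p))
  · refine (hG.lpSum_cells_succ_le hp fun Q hQ P hP =>
      hG.enorm_stdCoeff_le D s hp f hQ hP).trans ?_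
    rw [lpSum_const_mul _ hp, ← mul_assoc, ← ENNReal.ofReal_mul (by positivity)]
    gcongr

end Grid.IsGood

/-! ### The four norms -/

/-- `N` is subadditive and homogeneous on the integrable functions, with values in `[0, ∞]`. The
inequality `mul_le` is an equality, see `IsExtendedSeminorm.mul_eq`. -/
structure IsExtendedSeminorm (m : Measure I) (N : (I → ℂ) → ℝ≥0∞) : Prop where
  add_le : ∀ f g, Integrable f m → Integrable g m → N (fun x => f x + g x) ≤ N f + N g
  mul_le : ∀ z f, N (fun x => z * f x) ≤ ‖z‖ₑ * N f

lemma IsExtendedSeminorm.mul_eq {N : (I → ℂ) → ℝ≥0∞} (hN : IsExtendedSeminorm m N) (z : ℂ)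
    (f : I → ℂ) : N (fun x => z * f x) = ‖z‖ₑ * N f := by
  refine (hN.mul_le z f).antisymm ?_
  obtain rfl | hz := eq_or_ne z 0
  · simp only [enorm_zero, zero_mul, zero_le]
  · have h := hN.mul_le z⁻¹ fun x => z * f x
    simp only [inv_mul_cancel_left₀ hz] at h
    calc ‖z‖ₑ * N f ≤ ‖z‖ₑ * (‖z⁻¹‖ₑ * N fun x => z * f x) := by gcongr
      _ = N fun x => z * f x := by
        rw [← mul_assoc, ← enorm_mul, mul_inv_cancel₀ hz, enorm_one, one_mul]

/-- On the integrable functions `N` is bounded by a finite multiple of `N'`. -/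
def IsDominatedBy (m : Measure I) (N N' : (I → ℂ) → ℝ≥0∞) : Prop :=
  ∃ C ≠ ∞, ∀ f, Integrable f m → N f ≤ C * N' f

lemma IsDominatedBy.refl (m : Measure I) (N : (I → ℂ) → ℝ≥0∞) : IsDominatedBy m N N :=
  ⟨1, ENNReal.one_ne_top, fun _ _ => (one_mul _).ge⟩

lemma IsDominatedBy.trans {N₁ N₂ N₃ : (I → ℂ) → ℝ≥0∞} :
    IsDominatedBy m N₁ N₂ → IsDominatedBy m N₂ N₃ → IsDominatedBy m N₁ N₃
  | ⟨A, hA, h₁₂⟩, ⟨B, hB, h₂₃⟩ => ⟨A * B, ENNReal.mul_ne_top hA hB, fun f hf =>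
      (h₁₂ f hf).trans (by rw [mul_assoc]; gcongr; exact h₂₃ f hf)⟩

/-- Equivalence of `N` and `N'` as extended norms on the integrable functions. -/
def IsEquivalent (m : Measure I) (N N' : (I → ℂ) → ℝ≥0∞) : Prop :=
  IsDominatedBy m N N' ∧ IsDominatedBy m N' N

lemma IsEquivalent.refl (m : Measure I) (N : (I → ℂ) → ℝ≥0∞) : IsEquivalent m N N :=
  ⟨.refl m N, .refl m N⟩

namespace Grid

variable {s p : ℝ} {q : ℝ≥0∞}

lemma IsRepresentation.besovNorm_le {c : Set I → ℂ} {a : Set I → I → ℂ} {f : I → ℂ}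
    (h : G.IsRepresentation s p c a f) (q : ℝ≥0∞) : G.besovNorm s p q f ≤ G.cost p q c :=
  iInf_le_of_le c (iInf₂_le a h)

lemma cost_zero (hp : 0 < p) (hq : q ≠ 0) : G.cost p q (fun _ => 0) = 0 := by
  simp [cost, lpSum, hp, lqNorm_zero hq]

lemma isRepresentation_zero [IsFiniteMeasure m] {f : I → ℂ} (hf : f =ᵐ[m] fun _ => 0) :
    G.IsRepresentation s p (fun _ => 0) (canonicalAtom m s p) f := by
  have block_zero (k : ℕ) :
      G.block (fun _ => 0) (canonicalAtom m s p) k = fun _ => 0 := by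
    ext x
    simp only [block, zero_mul, Finset.sum_const_zero]
  refine ⟨fun k Q hQ => isSouzaAtom_canonicalAtom (G.measure_pos k Q hQ).ne', ?_, ?_⟩
  · simp only [block_zero, eLpNorm_zero', tsum_zero, ENNReal.zero_lt_top]
  · simp only [block_zero, Finset.sum_const_zero, sub_zero]
    rw [eLpNorm_congr_ae hf, eLpNorm_zero']
    exact tendsto_const_nhds

lemma besovNorm_eq_zero_of_ae [IsFiniteMeasure m] (hp : 0 < p) (hq : q ≠ 0) {f : I → ℂ}
    (hf : f =ᵐ[m] fun _ => 0) : G.besovNorm s p q f = 0 :=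
  nonpos_iff_eq_zero.1 (((isRepresentation_zero hf).besovNorm_le q).trans_eq (cost_zero hp hq))

lemma IsRepresentation.add {c c' : Set I → ℂ} {f g : I → ℂ} (hp : 1 ≤ p)
    (h : G.IsRepresentation s p c (canonicalAtom m s p) f)
    (h' : G.IsRepresentation s p c' (canonicalAtom m s p) g)
    (hf : AEStronglyMeasurable f m) (hg : AEStronglyMeasurable g m) :
    G.IsRepresentation s p (fun Q => c Q + c' Q) (canonicalAtom m s p) fun x => f x + g x := by
  have hp' : 1 ≤ ENNReal.ofReal p := ENNReal.one_le_ofReal.2 hp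
  have block_add (k : ℕ) : G.block (fun Q => c Q + c' Q) (canonicalAtom m s p) k =
      G.block c (canonicalAtom m s p) k + G.block c' (canonicalAtom m s p) k := by
    ext x
    simp only [block, Pi.add_apply, ← Finset.sum_add_distrib, add_mul]
  have aesm_block (c : Set I → ℂ) (k : ℕ) :
      AEStronglyMeasurable (G.block c (canonicalAtom m s p) k) m :=
    block_canonicalAtom (G := G) s p c k ▸ aestronglyMeasurable_stepFun k _
  have aesm_sub_sum {f : I → ℂ} (hf : AEStronglyMeasurable f m) (c : Set I → ℂ) (n : ℕ) :
      AEStronglyMeasurable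
        (fun x => f x - ∑ k ∈ Finset.range n, G.block c (canonicalAtom m s p) k x) m :=
    hf.sub (Finset.aestronglyMeasurable_fun_sum _ fun k _ => aesm_block c k)
  refine ⟨h.atom, ?_, ?_⟩
  · refine lt_of_le_of_lt ?_ (ENNReal.add_lt_top.2 ⟨h.abs_conv, h'.abs_conv⟩)
    rw [← ENNReal.tsum_add]
    refine ENNReal.tsum_le_tsum fun k => ?_
    rw [block_add]
    exact eLpNorm_add_le (aesm_block c k) (aesm_block c' k) hp'
  · refine tendsto_of_tendsto_of_tendsto_of_le_of_le tendsto_const_nhds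
      ((h.tendsto.add h'.tendsto).trans_eq (by rw [add_zero])) (fun _ => zero_le) fun n => ?_
    refine le_trans (le_of_eq ?_)
      (eLpNorm_add_le (aesm_sub_sum hf c n) (aesm_sub_sum hg c' n) hp')
    congr 1
    ext x
    simp only [block_add, Pi.add_apply, Finset.sum_add_distrib]
    ring

lemma cost_add_le (hp : 1 ≤ p) (hq : 1 ≤ q) (c c' : Set I → ℂ) :
    G.cost p q (fun Q => c Q + c' Q) ≤ G.cost p q c + G.cost p q c' :=
  lqNorm_lpSum_le_add hq hp fun _ _ _ => enorm_add_le _ _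

lemma besovNorm_add_le [IsFiniteMeasure m] (hp : 1 ≤ p) (hq : 1 ≤ q) {f g : I → ℂ}
    (hf : AEStronglyMeasurable f m) (hg : AEStronglyMeasurable g m) :
    G.besovNorm s p q (fun x => f x + g x) ≤ G.besovNorm s p q f + G.besovNorm s p q g := by
  have hp0 : 0 ≤ p := zero_le_one.trans hp
  rw [besovNorm.eq_def G s p q f, besovNorm.eq_def G s p q g]
  simp only [ENNReal.iInf_add, ENNReal.add_iInf]
  refine le_iInf fun c' => le_iInf fun a' => le_iInf fun h' =>
    le_iInf fun c => le_iInf fun a => le_iInf fun h => ?_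
  obtain ⟨d, hd, h⟩ := h.exists_canonical
  obtain ⟨d', hd', h'⟩ := h'.exists_canonical
  calc G.besovNorm s p q (fun x => f x + g x) ≤ G.cost p q fun Q => d Q + d' Q :=
        (h.add hp h' hf hg).besovNorm_le q
    _ ≤ G.cost p q d + G.cost p q d' := cost_add_le hp hq d d'
    _ ≤ G.cost p q c + G.cost p q c' := add_le_add (cost_mono hp0 hd) (cost_mono hp0 hd')

lemma IsRepresentation.const_mul {c : Set I → ℂ} {a : Set I → I → ℂ} {f : I → ℂ}
    (h : G.IsRepresentation s p c a f) (z : ℂ) :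
    G.IsRepresentation s p (fun Q => z * c Q) a fun x => z * f x := by
  have block_mul (k : ℕ) : G.block (fun Q => z * c Q) a k = z • G.block c a k := by
    ext x
    simp only [block, Pi.smul_apply, smul_eq_mul, Finset.mul_sum, mul_assoc]
  refine ⟨h.atom, ?_, ?_⟩
  · simp only [block_mul, eLpNorm_const_smul, ENNReal.tsum_mul_left]
    exact ENNReal.mul_lt_top enorm_lt_top h.abs_conv
  · have hlim := ENNReal.Tendsto.const_mul (a := ‖z‖ₑ) h.tendsto (.inr enorm_ne_top)
    rw [mul_zero] at hlim
    refine hlim.congr fun n => ?_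
    rw [← eLpNorm_const_smul]
    congr 1
    ext x
    simp only [block_mul, Pi.smul_apply, smul_eq_mul, mul_sub, Finset.mul_sum]

lemma besovNorm_const_mul_le [IsFiniteMeasure m] (hp : 0 < p) (hq : q ≠ 0) (z : ℂ) (f : I → ℂ) :
    G.besovNorm s p q (fun x => z * f x) ≤ ‖z‖ₑ * G.besovNorm s p q f := by
  obtain rfl | hz := eq_or_ne z 0
  · rw [besovNorm_eq_zero_of_ae hp hq (by simp)]
    exact zero_le
  · simp only [besovNorm.eq_def G s p q f, ENNReal.mul_iInf_of_ne (enorm_ne_zero.2 hz) enorm_ne_top]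
    refine le_iInf fun c => le_iInf fun a => le_iInf fun h => ?_
    exact ((h.const_mul z).besovNorm_le q).trans
      (lqNorm_lpSum_le_mul hq hp fun _ _ _ => (enorm_mul _ _).le)

lemma integrable_of_mem_besovSpace [IsFiniteMeasure m] (hp : 1 ≤ p) {f : I → ℂ}
    (hf : f ∈ G.besovSpace s p q) : Integrable f m :=
  hf.1.integrable (ENNReal.one_le_ofReal.2 hp)

theorem isExtendedSeminorm_besovNorm [IsFiniteMeasure m] (s : ℝ) (hp : 1 ≤ p) (hq : 1 ≤ q) :
    IsExtendedSeminorm m (G.besovNorm s p q) where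
  add_le _ _ hf hg := besovNorm_add_le hp hq hf.1 hg.1
  mul_le := besovNorm_const_mul_le (one_pos.trans_le hp) (one_pos.trans_le hq).ne'

end Grid

lemma osc_const_mul_le {p : ℝ} (hp : 0 < p) (z : ℂ) (f : I → ℂ) (Q : Set I) :
    osc m p (fun x => z * f x) Q ≤ ‖z‖ₑ * osc m p f Q := by
  have le_mul (c : ℂ) : osc m p (fun x => z * f x) Q ≤
      ‖z‖ₑ * (∫⁻ x in Q, ‖f x - c‖ₑ ^ p ∂m) ^ (1 / p) := by
    refine (iInf_le _ (z * c)).trans_eq ?_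
    rw [← eLpNorm_ofReal hp (fun x => f x - c), ← eLpNorm_const_smul,
      ← eLpNorm_ofReal hp fun x => z * f x - z * c]
    simp only [← mul_sub]
    rfl
  obtain rfl | hz := eq_or_ne z 0
  · simpa using le_mul 0
  · simp only [osc.eq_def m p f, ENNReal.mul_iInf_of_ne (enorm_ne_zero.2 hz) enorm_ne_top]
    exact le_iInf le_mul

lemma osc_add_le {p : ℝ} (hp : 1 ≤ p) {f g : I → ℂ} (hf : AEStronglyMeasurable f m)
    (hg : AEStronglyMeasurable g m) (Q : Set I) :
    osc m p (fun x => f x + g x) Q ≤ osc m p f Q + osc m p g Q := by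
  have hp0 : 0 < p := one_pos.trans_le hp
  simp only [osc, ENNReal.iInf_add, ENNReal.add_iInf]
  refine le_iInf fun c' => le_iInf fun c => (iInf_le _ (c + c')).trans ?_
  simp only [add_sub_add_comm]
  rw [← eLpNorm_ofReal hp0 (fun x => f x - c), ← eLpNorm_ofReal hp0 (fun x => g x - c'),
    ← eLpNorm_ofReal hp0 fun x => f x - c + (g x - c')]
  exact eLpNorm_add_le (hf.sub aestronglyMeasurable_const).restrict
    (hg.sub aestronglyMeasurable_const).restrict (ENNReal.one_le_ofReal.2 hp)

theorem Grid.isExtendedSeminorm_oscNorm (s : ℝ) {p : ℝ} (hp : 1 ≤ p) {q : ℝ≥0∞} (hq : 1 ≤ q) :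
    IsExtendedSeminorm m (G.oscNorm s p q) where
  add_le f g hf hg := by
    rw [oscNorm_eq (one_pos.trans_le hp), oscNorm_eq (one_pos.trans_le hp),
      oscNorm_eq (one_pos.trans_le hp), add_add_add_comm, ← mul_add]
    refine add_le_add ?_ (lqNorm_lpSum_le_add hq hp fun k Q _ => ?_)
    · gcongr
      exact eLpNorm_add_le hf.1 hg.1 (ENNReal.one_le_ofReal.2 hp)
    · rw [← mul_add]
      gcongr
      exact osc_add_le hp hf.1 hg.1 Q
  mul_le z f := by
    have hp0 : 0 < p := one_pos.trans_le hp
    rw [oscNorm_eq hp0, oscNorm_eq hp0, mul_add, mul_left_comm, ← eLpNorm_const_smul]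
    refine add_le_add le_rfl (lqNorm_lpSum_le_mul (one_pos.trans_le hq).ne' hp0 fun k Q _ => ?_)
    rw [mul_left_comm]
    gcongr
    exact osc_const_mul_le hp0 z f Q

lemma haarCoeff_const_mul (z : ℂ) (f : I → ℂ) (S : Finset (Set I) × Finset (Set I)) :
    haarCoeff m (fun x => z * f x) S = z * haarCoeff m f S := by
  simp only [haarCoeff, mul_assoc, integral_const_mul]

lemma haarCoeffTop_const_mul (z : ℂ) (f : I → ℂ) :
    haarCoeffTop m (fun x => z * f x) = z * haarCoeffTop m f := by
  simp only [haarCoeffTop, mul_assoc, integral_const_mul]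

lemma haarCoeffTop_add {f g : I → ℂ} (hf : Integrable f m) (hg : Integrable g m) :
    haarCoeffTop m (fun x => f x + g x) = haarCoeffTop m f + haarCoeffTop m g := by
  simp only [haarCoeffTop_eq, integral_add hf hg, add_mul]

lemma Grid.stdCoeff_const_mul (D : G.Choices) (s p : ℝ) (z : ℂ) (f : I → ℂ) (k : ℕ)
    (P : Set I) : G.stdCoeff D s p (fun x => z * f x) k P = z * G.stdCoeff D s p f k P := by
  cases k with
  | zero => rw [stdCoeff, stdCoeff, haarCoeffTop_const_mul, mul_left_comm]
  | succ k =>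
    rw [stdCoeff, stdCoeff, mul_left_comm]
    simp only [haarCoeff_const_mul, Finset.mul_sum, mul_assoc]

namespace Grid.IsGood

variable (hG : G.IsGood l₁ l₂) [IsFiniteMeasure m]
include hG

lemma haarCoeff_add (D : G.Choices) {f g : I → ℂ} (hf : Integrable f m) (hg : Integrable g m)
    {k : ℕ} {Q : Set I} (hQ : Q ∈ G.cells k) {S : Finset (Set I) × Finset (Set I)}
    (hS : S ∈ G.haarFamily D k Q) :
    haarCoeff m (fun x => f x + g x) S = haarCoeff m f S + haarCoeff m g S := by
  rw [hG.haarCoeff_eq_sum D hf 0 hQ hS, hG.haarCoeff_eq_sum D hg 0 hQ hS,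
    hG.haarCoeff_eq_sum D (f := fun x => f x + g x) (hf.add hg) 0 hQ hS, ← Finset.sum_add_distrib]
  simp only [sub_zero, ← smul_add, integral_add hf.integrableOn hg.integrableOn]

lemma stdCoeff_add (D : G.Choices) (s p : ℝ) {f g : I → ℂ} (hf : Integrable f m)
    (hg : Integrable g m) (k : ℕ) (P : Set I) :
    G.stdCoeff D s p (fun x => f x + g x) k P =
      G.stdCoeff D s p f k P + G.stdCoeff D s p g k P := by
  classical
  cases k with
  | zero => rw [stdCoeff, stdCoeff, stdCoeff, haarCoeffTop_add hf hg, mul_add]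
  | succ k =>
    simp only [stdCoeff, ← mul_add, ← Finset.sum_add_distrib]
    refine congrArg _ (Finset.sum_congr rfl fun Q hQ => Finset.sum_congr rfl fun S hS => ?_)
    rw [hG.haarCoeff_add D hf hg (Finset.mem_filter.1 hQ).1 hS, add_mul]

theorem isExtendedSeminorm_haarNorm (D : G.Choices) (s : ℝ) {p : ℝ} (hp : 1 ≤ p) {q : ℝ≥0∞}
    (hq : 1 ≤ q) : IsExtendedSeminorm m (G.haarNorm D s p q) where
  add_le f g hf hg := by
    have hp0 : 0 < p := one_pos.trans_le hp
    rw [haarNorm_eq hp0, haarNorm_eq hp0, haarNorm_eq hp0, add_add_add_comm, ← mul_add,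
      haarCoeffTop_add hf hg]
    refine add_le_add (by gcongr; exact enorm_add_le _ _)
      (lqNorm_lpSum_le_add hq hp fun k Q hQ => ?_)
    rw [← mul_add]
    gcongr
    refine (lpSum_mono _ hp0.le fun S hS => ?_).trans (lpSum_add_le _ hp _ _)
    rw [hG.haarCoeff_add D hf hg hQ hS]
    exact enorm_add_le _ _
  mul_le z f := by
    have hp0 : 0 < p := one_pos.trans_le hp
    rw [haarNorm_eq hp0, haarNorm_eq hp0, haarCoeffTop_const_mul, enorm_mul, mul_add,
      mul_left_comm]
    refine add_le_add le_rfl (lqNorm_lpSum_le_mul (one_pos.trans_le hq).ne' hp0 fun k Q _ => ?_)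
    simp only [haarCoeff_const_mul, enorm_mul, lpSum_const_mul _ hp0, mul_left_comm, le_refl]

theorem isExtendedSeminorm_stdNorm (D : G.Choices) (s : ℝ) {p : ℝ} (hp : 1 ≤ p) {q : ℝ≥0∞}
    (hq : 1 ≤ q) : IsExtendedSeminorm m (G.stdNorm D s p q) where
  add_le f g hf hg := by
    simp only [stdNorm, hG.stdCoeff_add D s p hf hg]
    rw [add_add_add_comm]
    exact add_le_add (enorm_add_le _ _) (lqNorm_lpSum_le_add hq hp fun _ _ _ => enorm_add_le _ _)
  mul_le z f := by
    simp only [stdNorm, stdCoeff_const_mul, enorm_mul, mul_add]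
    exact add_le_add le_rfl (lqNorm_lpSum_le_mul (one_pos.trans_le hq).ne'
      (one_pos.trans_le hp) fun _ _ _ => le_rfl)

variable {s p : ℝ} {q : ℝ≥0∞} (hs : 0 < s) (hp : 1 ≤ p) (hq : 1 ≤ q)
include hs hp hq

lemma ae_eq_zero_of_besovNorm_eq_zero {f : I → ℂ} (hf : AEStronglyMeasurable f m)
    (h : G.besovNorm s p q f = 0) : f =ᵐ[m] fun _ => 0 := by
  have oscNorm_zero : G.oscNorm s p q f = 0 :=
    nonpos_iff_eq_zero.1 ((hG.oscNorm_le_besovNorm hs hp hq hf).trans_eq (by rw [h, mul_zero]))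
  have weight_ne_zero : m Set.univ ^ (-s) ≠ 0 :=
    (ENNReal.rpow_pos hG.measure_univ_pos (measure_ne_top _ _)).ne'
  rw [oscNorm, add_eq_zero, mul_eq_zero, or_iff_right weight_ne_zero] at oscNorm_zero
  exact (eLpNorm_eq_zero_iff hf (by simpa using one_pos.trans_le hp)).1 oscNorm_zero.1

theorem isEquivalent_besovNorm (D : G.Choices) :
    IsEquivalent m (G.besovNorm s p q) (G.stdNorm D s p q) ∧
      IsEquivalent m (G.besovNorm s p q) (G.haarNorm D s p q) ∧
      IsEquivalent m (G.besovNorm s p q) (G.oscNorm s p q) := by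
  have hp0 : 0 < p := one_pos.trans_le hp
  have hq0 : q ≠ 0 := (one_pos.trans_le hq).ne'
  have besov_std : IsDominatedBy m (G.besovNorm s p q) (G.stdNorm D s p q) :=
    ⟨1, ENNReal.one_ne_top, fun f hf =>
      (hG.besovNorm_le_stdNorm D hs hp hq hf).trans_eq (one_mul _).symm⟩
  have std_haar : IsDominatedBy m (G.stdNorm D s p q) (G.haarNorm D s p q) :=
    ⟨_, ENNReal.ofReal_ne_top, fun f _ => hG.stdNorm_le_haarNorm D s hp0 hq0 f⟩
  have haar_osc : IsDominatedBy m (G.haarNorm D s p q) (G.oscNorm s p q) :=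
    ⟨_, ENNReal.ofReal_ne_top, fun f hf => hG.haarNorm_le_oscNorm D hp hq hf⟩
  have osc_besov : IsDominatedBy m (G.oscNorm s p q) (G.besovNorm s p q) :=
    ⟨_, (hG.oscConst_lt_top hs hp0 hq).ne, fun f hf => hG.oscNorm_le_besovNorm hs hp hq hf.1⟩
  exact ⟨⟨besov_std, std_haar.trans (haar_osc.trans osc_besov)⟩,
    ⟨besov_std.trans std_haar, haar_osc.trans osc_besov⟩,
    ⟨(besov_std.trans std_haar).trans haar_osc, osc_besov⟩⟩

lemma lt_top_iff_mem_besovSpace {N : (I → ℂ) → ℝ≥0∞} (hN : IsEquivalent m (G.besovNorm s p q) N)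
    {f : I → ℂ} (hf : Integrable f m) : N f < ∞ ↔ f ∈ G.besovSpace s p q := by
  obtain ⟨⟨A, hA, hBN⟩, B, hB, hNB⟩ := hN
  rw [← hG.besovNorm_lt_top_iff hs hp hq hf.1]
  exact ⟨fun h => (hBN f hf).trans_lt (ENNReal.mul_lt_top hA.lt_top h),
    fun h => (hNB f hf).trans_lt (ENNReal.mul_lt_top hB.lt_top h)⟩

lemma eq_zero_iff_ae_eq_zero {N : (I → ℂ) → ℝ≥0∞} (hN : IsEquivalent m (G.besovNorm s p q) N)
    {f : I → ℂ} (hf : Integrable f m) : N f = 0 ↔ f =ᵐ[m] fun _ => 0 := by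
  obtain ⟨⟨A, -, hBN⟩, B, -, hNB⟩ := hN
  refine ⟨fun h => hG.ae_eq_zero_of_besovNorm_eq_zero hs hp hq hf.1 ?_, fun h => ?_⟩
  · exact nonpos_iff_eq_zero.1 ((hBN f hf).trans_eq (by rw [h, mul_zero]))
  · refine nonpos_iff_eq_zero.1 ((hNB f hf).trans_eq ?_)
    rw [besovNorm_eq_zero_of_ae (one_pos.trans_le hp) (one_pos.trans_le hq).ne' h, mul_zero]

theorem isNormOn_besovSpace {N : (I → ℂ) → ℝ≥0∞} (hN : IsExtendedSeminorm m N)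
    (hBN : IsEquivalent m (G.besovNorm s p q) N) :
    IsNormOn m (G.besovSpace s p q) N := by
  have integrable {f : I → ℂ} (hf : f ∈ G.besovSpace s p q) : Integrable f m :=
    integrable_of_mem_besovSpace hp hf
  have lt_top_iff {f : I → ℂ} (hf : Integrable f m) : N f < ∞ ↔ f ∈ G.besovSpace s p q :=
    hG.lt_top_iff_mem_besovSpace hs hp hq hBN hf
  have lt_top {f : I → ℂ} (hf : f ∈ G.besovSpace s p q) : N f < ∞ :=
    (lt_top_iff (integrable hf)).2 hf
  refine ⟨(lt_top_iff (integrable_zero _ _ _)).1 ?_, fun f hf g hg => ?_, fun z f hf => ?_,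
    fun f => lt_top, fun f hf g hg => hN.add_le f g (integrable hf) (integrable hg),
    fun z f _ => hN.mul_eq z f, fun f hf => ?_⟩
  · have zero_eq := hN.mul_eq 0 fun _ => 0
    simp only [mul_zero, enorm_zero, zero_mul] at zero_eq
    exact zero_eq.trans_lt ENNReal.zero_lt_top
  · exact (lt_top_iff ((integrable hf).add (integrable hg))).1
      ((hN.add_le f g (integrable hf) (integrable hg)).trans_lt
        (ENNReal.add_lt_top.2 ⟨lt_top hf, lt_top hg⟩))
  · exact (lt_top_iff ((integrable hf).const_mul z)).1
      ((hN.mul_le z f).trans_lt (ENNReal.mul_lt_top enorm_lt_top (lt_top hf)))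
  · exact hG.eq_zero_iff_ae_eq_zero hs hp hq hBN (integrable hf)

end Grid.IsGood

end GridBesov

end

theorem theorem13p1 {I : Type*} [MeasurableSpace I] (m : Measure I) [IsFiniteMeasure m]
    (G : GridBesov.Grid m) (l₁ l₂ : ℝ) (hG : G.IsGood l₁ l₂) (D : G.Choices)
    (s p : ℝ) (q : ℝ≥0∞) (hs : 0 < s) (hp : 1 ≤ p) (hq : 1 ≤ q) :
    (∀ f : I → ℂ, Integrable f m →
      ((G.besovNorm s p q f < ∞ ↔ f ∈ G.besovSpace s p q) ∧
        (G.stdNorm D s p q f < ∞ ↔ f ∈ G.besovSpace s p q) ∧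
        (G.haarNorm D s p q f < ∞ ↔ f ∈ G.besovSpace s p q) ∧
        (G.oscNorm s p q f < ∞ ↔ f ∈ G.besovSpace s p q)) ∧
      G.besovNorm s p q f ≤ G.stdNorm D s p q f ∧
      G.stdNorm D s p q f ≤
        ENNReal.ofReal (GridBesov.stdConst l₁ l₂ s p) * G.haarNorm D s p q f ∧
      G.haarNorm D s p q f ≤
        ENNReal.ofReal (GridBesov.waveletConst l₁ l₂) * G.oscNorm s p q f ∧
      G.oscNorm s p q f ≤ G.oscConst l₂ s p q * G.besovNorm s p q f) ∧
    G.oscConst l₂ s p q < ∞ ∧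
    (∀ f ∈ G.besovSpace s p q, Integrable f m) ∧
    GridBesov.IsNormOn m (G.besovSpace s p q) (G.besovNorm s p q) ∧
    GridBesov.IsNormOn m (G.besovSpace s p q) (G.stdNorm D s p q) ∧
    GridBesov.IsNormOn m (G.besovSpace s p q) (G.haarNorm D s p q) ∧
    GridBesov.IsNormOn m (G.besovSpace s p q) (G.oscNorm s p q) := by
  obtain ⟨hstd, hhaar, hosc⟩ := hG.isEquivalent_besovNorm (m := m) hs hp hq D
  have hbesov := GridBesov.IsEquivalent.refl m (G.besovNorm s p q)
  have hp0 : 0 < p := one_pos.trans_le hp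
  refine ⟨fun f hf => ⟨⟨?_, ?_, ?_, ?_⟩, hG.besovNorm_le_stdNorm D hs hp hq hf,
    hG.stdNorm_le_haarNorm D s hp0 (one_pos.trans_le hq).ne' f, hG.haarNorm_le_oscNorm D hp hq hf,
    hG.oscNorm_le_besovNorm hs hp hq hf.1⟩, hG.oscConst_lt_top hs hp0 hq,
    fun f => GridBesov.Grid.integrable_of_mem_besovSpace hp, ?_, ?_, ?_, ?_⟩
  · exact hG.lt_top_iff_mem_besovSpace hs hp hq hbesov hf
  · exact hG.lt_top_iff_mem_besovSpace hs hp hq hstd hf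
  · exact hG.lt_top_iff_mem_besovSpace hs hp hq hhaar hf
  · exact hG.lt_top_iff_mem_besovSpace hs hp hq hosc hf
  · exact hG.isNormOn_besovSpace hs hp hq
      (GridBesov.Grid.isExtendedSeminorm_besovNorm s hp hq) hbesov
  · exact hG.isNormOn_besovSpace hs hp hq (hG.isExtendedSeminorm_stdNorm D s hp hq) hstd
  · exact hG.isNormOn_besovSpace hs hp hq (hG.isExtendedSeminorm_haarNorm D s hp hq) hhaar
  · exact hG.isNormOn_besovSpace hs hp hq (GridBesov.Grid.isExtendedSeminorm_oscNorm s hp hq) hosc
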